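/- **Setting.** Let $\mathbb F\in\{\mathbb R,\mathbb C\}$, let $k\ge 1$, and let $A-\lambda B$ with $A,B\in\mathbb F^{n\times n}$ be a singular pencil of normal rank $\max_\zeta \operatorname{rank}(A-\zeta B)=n-k$. Let $\lambda_i\in\mathbb F$ be a finite simple eigenvalue, that is, a simple root of $\det R(\lambda)$, where $R(\lambda)$ is the regular part in the Kronecker canonical form of $A-\lambda B$. A subspace $\mathcal M\subseteq\mathbb F^n$ is reducing for $A-\lambda B$ if $\dim(A\mathcal M+B\mathcal M)=\dim\mathcal M-k$; let $\mathcal M_{\rm RS}$ be the intersection of all reducing subspaces of $A-\lambda B$, and $\mathcal L_{\rm RS}$ that of all reducing subspaces of $A^*-\lambda B^*$. Let $X=[X_1\ x]$ and $Y=[Y_1\ y]$ be $n\times(k+1)$ matrices over $\mathbb F$ with orthonormal columns such that the columns of $X$, $X_1$, $Y$, $Y_1$ are bases of $\ker(A-\lambda_iB)$, $\ker(A-\lambda_iB)\cap\mathcal M_{\rm RS}$, $\ker((A-\lambda_iB)^*)$ and $\ker((A-\lambda_iB)^*)\cap\mathcal L_{\rm RS}$, respectively. Let $U,V$ be independent random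 $n\times k$ matrices, each uniformly distributed on the Stiefel manifold $\{Q\in\mathbb F^{n\times k}: Q^*Q=I\}$. Let $0\ne\tau\in\mathbb F$, and let $D_A,D_B\in\mathbb F^{k\times k}$ be diagonal matrices (deterministic, or random with any joint law) such that, almost surely, $\det(D_A-\lambda_iD_B)\ne0$. Let $x_i,y_i\in\mathbb F^n$ be right and left eigenvectors with $\|x_i\|_2=\|y_i\|_2=1$, for the eigenvalue $\lambda_i$, of the modified (almost surely regular) pencil $$A-\lambda B+\tau\,(UD_AV^*-\lambda\,UD_BV^*).$$ Let $\alpha_{\mathbb F}=x^*x_i$ and $\beta_{\mathbb F}=y^*y_i$ be the coefficients of $x_i$ along $x$ and of $y_i$ along $y$. **Proposition.** In this setting, almost surely, $x_i=X_1a+\alpha_{\mathbb F}\,x$ and $y_i=Y_1b+\beta_{\mathbb F}\,y$ for some $a,b\in\mathbb F^k$, and $V^*x_i=0$, $U^*y_i=0$. Moreover: 1. If $\mathbb F=\mathbb C$, then for every $0<t\le 1$, $$\mathbb P\left(|\alpha_{\mathbb C}||\beta_{\mathbb C}|<t\right)\le k^2t^2(1-2\ln t).$$ 2. If $\mathbb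 F=\mathbb R$, then $$\mathbb P\left(|\alpha_{\mathbb R}||\beta_{\mathbb R}|<t\right)\le\frac{2k}{\pi}\,t\,(-\ln t)+O(t)\qquad (t\to0^+),$$ where the implied constant and the range of $t$ depend only on $k$. -/

import Mathlib

open MeasureTheory ProbabilityTheory
open scoped Matrix

/-- The product (Borel) sigma-algebra on matrices, generated by the entries. -/
instance Matrix.entrywiseMeasurableSpace {m n R : Type*} [MeasurableSpace R] :
    MeasurableSpace (Matrix m n R) :=
  inferInstanceAs (MeasurableSpace (m → n → R))

namespace SingularPencil

/-! A pencil `A - z B` is given by the pair `(A, B)` of its coefficient matrices. -/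

section Pencils

variable {𝕜 : Type*} [RCLike 𝕜] {n : ℕ}

/-- The normal rank `max_z rank (A - z B)`. The set of ranks is bounded by `n`, so the supremum is
a maximum. -/
noncomputable def nrank (A B : Matrix (Fin n) (Fin n) 𝕜) : ℕ :=
  sSup (Set.range fun z : 𝕜 => (A - z • B).rank)

/-- The constant coefficient of `diag (L_{m 1}, ..., L_{m k})`, where
`L_j (z) = [0 I_j] - z [I_j 0]` has size `j × (j + 1)`. -/
def singularBlocksA (𝕜 : Type*) [RCLike 𝕜] {k : ℕ} (m : Fin k → ℕ) :
    Matrix (Σ i, Fin (m i)) (Σ i, Fin (m i + 1)) 𝕜 :=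
  Matrix.blockDiagonal' fun _ => Matrix.of fun a b => if b = a.succ then 1 else 0

/-- The coefficient of `-z` of `diag (L_{m 1}, ..., L_{m k})`. -/
def singularBlocksB (𝕜 : Type*) [RCLike 𝕜] {k : ℕ} (m : Fin k → ℕ) :
    Matrix (Σ i, Fin (m i)) (Σ i, Fin (m i + 1)) 𝕜 :=
  Matrix.blockDiagonal' fun _ => Matrix.of fun a b => if b = a.castSucc then 1 else 0

/-- `A - z B` is strictly equivalent to `diag (R(z), S(z))` with the regular part
`R(z) = diag (J - z I, I - z N)`, `N` nilpotent, and the singular part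
`S(z) = diag (L_{m 1}, ..., L_{m k}, L_{l 1}ᵀ, ..., L_{l k}ᵀ)`. The Jordan normalization of `J`
and `N` is left out: it only changes the transformation matrices (and over `ℝ` a Jordan form of `J`
need not exist). -/
def HasKroneckerForm (A B : Matrix (Fin n) (Fin n) 𝕜) {r s k : ℕ}
    (J : Matrix (Fin r) (Fin r) 𝕜) (N : Matrix (Fin s) (Fin s) 𝕜) (m l : Fin k → ℕ) : Prop :=
  IsNilpotent N ∧
  ∃ (P : Matrix ((Fin r ⊕ Fin s) ⊕ ((Σ i, Fin (m i)) ⊕ (Σ i, Fin (l i + 1)))) (Fin n) 𝕜)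
    (P' : Matrix (Fin n) ((Fin r ⊕ Fin s) ⊕ ((Σ i, Fin (m i)) ⊕ (Σ i, Fin (l i + 1)))) 𝕜)
    (Q : Matrix (Fin n) ((Fin r ⊕ Fin s) ⊕ ((Σ i, Fin (m i + 1)) ⊕ (Σ i, Fin (l i)))) 𝕜)
    (Q' : Matrix ((Fin r ⊕ Fin s) ⊕ ((Σ i, Fin (m i + 1)) ⊕ (Σ i, Fin (l i)))) (Fin n) 𝕜),
    (P * P' = 1 ∧ P' * P = 1) ∧ (Q * Q' = 1 ∧ Q' * Q = 1) ∧
    P * A * Q = Matrix.fromBlocks (Matrix.fromBlocks J 0 0 1) 0 0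
      (Matrix.fromBlocks (singularBlocksA 𝕜 m) 0 0 (singularBlocksA 𝕜 l)ᵀ) ∧
    P * B * Q = Matrix.fromBlocks (Matrix.fromBlocks 1 0 0 N) 0 0
      (Matrix.fromBlocks (singularBlocksB 𝕜 m) 0 0 (singularBlocksB 𝕜 l)ᵀ)

/-- The polynomial `det R(z)` of the regular part `R(z) = diag (J - z I, I - z N)`. -/
noncomputable def regularPartDet {r s : ℕ} (J : Matrix (Fin r) (Fin r) 𝕜)
    (N : Matrix (Fin s) (Fin s) 𝕜) : Polynomial 𝕜 :=
  ((Matrix.fromBlocks J 0 0 1).map Polynomial.C -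
    (Polynomial.X : Polynomial 𝕜) • (Matrix.fromBlocks 1 0 0 N).map Polynomial.C).det

/-- `z₀` is a finite simple eigenvalue of `A - z B`: a simple root of the determinant of the regular
part in the Kronecker form. -/
def IsSimpleEigenvalue (A B : Matrix (Fin n) (Fin n) 𝕜) (z₀ : 𝕜) : Prop :=
  ∃ (r s k : ℕ) (J : Matrix (Fin r) (Fin r) 𝕜) (N : Matrix (Fin s) (Fin s) 𝕜) (m l : Fin k → ℕ),
    HasKroneckerForm A B J N m l ∧ (regularPartDet J N).rootMultiplicity z₀ = 1

/-- `M` is a reducing subspace: `dim (A M + B M) = dim M - (n - nrank (A, B))`. -/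
def IsReducing (A B : Matrix (Fin n) (Fin n) 𝕜) (M : Submodule 𝕜 (Fin n → 𝕜)) : Prop :=
  Module.finrank 𝕜 ↥(M.map A.mulVecLin ⊔ M.map B.mulVecLin) + (n - nrank A B) =
    Module.finrank 𝕜 ↥M

/-- The minimal reducing subspace: the intersection of all reducing subspaces. -/
noncomputable def minReducing (A B : Matrix (Fin n) (Fin n) 𝕜) : Submodule 𝕜 (Fin n → 𝕜) :=
  sInf {M | IsReducing A B M}

/-- The minimal left reducing subspace (left reducing subspaces are those with
`dim (Aᴴ L + Bᴴ L) = dim L - (n - nrank (A, B))`, and `(Aᴴ, Bᴴ)` has the normal rank of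
`(A, B)`). -/
noncomputable def minLeftReducing (A B : Matrix (Fin n) (Fin n) 𝕜) : Submodule 𝕜 (Fin n → 𝕜) :=
  minReducing Aᴴ Bᴴ

/-- `x` is a right eigenvector of `A - z B` for `z₀`. For a regular pencil the last condition is
`x ≠ 0`. -/
def IsRightEigenvector (A B : Matrix (Fin n) (Fin n) 𝕜) (z₀ : 𝕜) (x : Fin n → 𝕜) : Prop :=
  x ≠ 0 ∧ (A - z₀ • B) *ᵥ x = 0 ∧ x ∉ minReducing A B

/-- `y` is a left eigenvector of `A - z B` for `z₀`: `yᴴ (A - z₀ B) = 0`. -/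
def IsLeftEigenvector (A B : Matrix (Fin n) (Fin n) 𝕜) (z₀ : 𝕜) (y : Fin n → 𝕜) : Prop :=
  y ≠ 0 ∧ star y ᵥ* (A - z₀ • B) = 0 ∧ y ∉ minLeftReducing A B

/-- The Stiefel manifold of matrices with orthonormal columns. -/
def stiefel (𝕜 ι κ : Type*) [RCLike 𝕜] [Fintype ι] [Fintype κ] [DecidableEq κ] :
    Set (Matrix ι κ 𝕜) :=
  {Q | Qᴴ * Q = 1}

/-- The matrix `[X₁ x]`. -/
def appendCol {k : ℕ} (X₁ : Matrix (Fin n) (Fin k) 𝕜) (x : Fin n → 𝕜) :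
    Matrix (Fin n) (Fin k ⊕ Unit) 𝕜 :=
  Matrix.fromCols X₁ (Matrix.replicateCol Unit x)

/-- `[X₁ x]` has orthonormal columns, the columns of `[X₁ x]` span `K` and those of `X₁` span
`K ∩ M`. -/
def IsAdaptedBasis {k : ℕ} (K M : Submodule 𝕜 (Fin n → 𝕜)) (X₁ : Matrix (Fin n) (Fin k) 𝕜)
    (x : Fin n → 𝕜) : Prop :=
  appendCol X₁ x ∈ stiefel 𝕜 (Fin n) (Fin k ⊕ Unit) ∧
  LinearMap.range (appendCol X₁ x).mulVecLin = K ∧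
  LinearMap.range X₁.mulVecLin = K ⊓ M

end Pencils

/-- The uniform distribution on the Stiefel manifold of `n × k` matrices over `𝕜`: the (unique)
Borel probability measure carried by the Stiefel manifold that is invariant under multiplication
from the left by all unitary (for `𝕜 = ℝ`, orthogonal) `n × n` matrices. -/
structure IsUniformStiefel {𝕜 : Type*} [RCLike 𝕜] [MeasurableSpace 𝕜] [BorelSpace 𝕜] {n k : ℕ}
    (ν : Measure (Matrix (Fin n) (Fin k) 𝕜)) : Prop where
  isProbabilityMeasure : IsProbabilityMeasure ν
  ae_mem : ∀ᵐ Q ∂ν, Q ∈ stiefel 𝕜 (Fin n) (Fin k)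
  map_unitary_mul : ∀ W ∈ Matrix.unitaryGroup (Fin n) 𝕜, ν.map (fun Q => W * Q) = ν

/-- A singular `n × n` pencil `A - z B` of normal rank `n - k` with a finite simple eigenvalue
`ev`, its random rank-completing modification
`A - z B + τ (U D_A Vᴴ - z U D_B Vᴴ)`, and normalized right and left eigenvectors `xi`, `yi` of the
modified pencil for the eigenvalue `ev`. -/
structure RankCompletingModification (𝕜 : Type*) [RCLike 𝕜] [MeasurableSpace 𝕜] [BorelSpace 𝕜]
    (n k : ℕ) {Ω : Type*} [MeasurableSpace Ω] (μ : Measure Ω) where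
  (A B : Matrix (Fin n) (Fin n) 𝕜)
  one_le_k : 1 ≤ k
  nrank_add : nrank A B + k = n
  ev : 𝕜
  simple : IsSimpleEigenvalue A B ev
  /-- The basis `[X₁ x]` of `ker (A - ev B)`. -/
  X₁ : Matrix (Fin n) (Fin k) 𝕜
  x : Fin n → 𝕜
  basis_right : IsAdaptedBasis (LinearMap.ker (A - ev • B).mulVecLin) (minReducing A B) X₁ x
  /-- The basis `[Y₁ y]` of `ker (A - ev B)ᴴ`. -/
  Y₁ : Matrix (Fin n) (Fin k) 𝕜
  y : Fin n → 𝕜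
  basis_left : IsAdaptedBasis (LinearMap.ker (A - ev • B)ᴴ.mulVecLin) (minLeftReducing A B) Y₁ y
  /-- The random matrices `U`, `V`. -/
  (U V : Ω → Matrix (Fin n) (Fin k) 𝕜)
  measurable_U : Measurable U
  measurable_V : Measurable V
  uniform_U : IsUniformStiefel (μ.map U)
  uniform_V : IsUniformStiefel (μ.map V)
  indep : IndepFun U V μ
  τ : 𝕜
  τ_ne_zero : τ ≠ 0
  /-- The diagonals of `D_A`, `D_B` (deterministic or random, with any joint law). -/
  (dA dB : Ω → Fin k → 𝕜)
  /-- `D_A - z D_B` is regular and `ev` is not one of its eigenvalues. -/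
  generic : ∀ᵐ ω ∂μ, (Matrix.diagonal (dA ω) - ev • Matrix.diagonal (dB ω)).det ≠ 0
  /-- The eigenvectors of the modified pencil. -/
  (xi yi : Ω → Fin n → 𝕜)
  xi_eigenvector : ∀ᵐ ω ∂μ, star (xi ω) ⬝ᵥ xi ω = 1 ∧
    IsRightEigenvector (A + τ • (U ω * Matrix.diagonal (dA ω) * (V ω)ᴴ))
      (B + τ • (U ω * Matrix.diagonal (dB ω) * (V ω)ᴴ)) ev (xi ω)
  yi_eigenvector : ∀ᵐ ω ∂μ, star (yi ω) ⬝ᵥ yi ω = 1 ∧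
    IsLeftEigenvector (A + τ • (U ω * Matrix.diagonal (dA ω) * (V ω)ᴴ))
      (B + τ • (U ω * Matrix.diagonal (dB ω) * (V ω)ᴴ)) ev (yi ω)

namespace RankCompletingModification

variable {𝕜 : Type*} [RCLike 𝕜] [MeasurableSpace 𝕜] [BorelSpace 𝕜] {n k : ℕ} {Ω : Type*}
  [MeasurableSpace Ω] {μ : Measure Ω}

/-- The coefficient `α` of `x` in the expansion `xi = X₁ a + α x`, i.e. (the columns of `[X₁ x]`
being orthonormal) `α = xᴴ xi`. -/
def α (S : RankCompletingModification 𝕜 n k μ) (ω : Ω) : 𝕜 := star S.x ⬝ᵥ S.xi ω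

/-- The coefficient `β` of `y` in the expansion `yi = Y₁ b + β y`. -/
def β (S : RankCompletingModification 𝕜 n k μ) (ω : Ω) : 𝕜 := star S.y ⬝ᵥ S.yi ω

/-- At the outcome `ω` the expansions `xi = X₁ a + α x` and `yi = Y₁ b + β y` that `α` and `β`
refer to are valid, with `Vᴴ xi = 0` and `Uᴴ yi = 0`. -/
def HasExpansions (S : RankCompletingModification 𝕜 n k μ) (ω : Ω) : Prop :=
  (∃ a : Fin k → 𝕜, S.xi ω = S.X₁ *ᵥ a + S.α ω • S.x) ∧
  (∃ b : Fin k → 𝕜, S.yi ω = S.Y₁ *ᵥ b + S.β ω • S.y) ∧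
  (S.V ω)ᴴ *ᵥ S.xi ω = 0 ∧ (S.U ω)ᴴ *ᵥ S.yi ω = 0

end RankCompletingModification

end SingularPencil

/-!
Let `M = A - ev B`. Its kernel has the orthonormal basis `X = [X₁ x]`, and the columns of
`Y = [Y₁ y]` are orthogonal to its range. At the eigenvalue the modified pencil is `M + U D Vᴴ` with
`D` invertible. Almost surely `det (Uᴴ Y₁) ≠ 0` (`IsUniformStiefel.ae_det_ne_zero`), so the ranges of
`M` and `U` meet trivially and `(M + U D Vᴴ) xi = 0` forces `M xi = 0` and `Vᴴ xi = 0`. Hence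
`xi = X c` with `c` a unit vector of the kernel of the `k × (k + 1)` matrix `Vᴴ X`. That kernel is
almost surely a line, so `‖α‖²`, the squared modulus of the last coordinate of `c`, is the last
diagonal entry of the projection `kerProj (Vᴴ X)` onto the line: a function of `V` alone. By the same
argument for the conjugate transposes, `‖β‖²` is a function of `U` alone, and the two are
independent.

The law of `V` is invariant under unitary maps from the left. Through `X` this makes the line
spanned by `c` uniformly distributed, in the following sense: the law of its component along a unit
vector `z` does not depend on `z`. Averaging over a Gaussian `z` and exchanging the integrals, where
the rotation invariance of the Gaussian measure is used, identifies the law of `‖α‖²` with that of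
`‖z_e‖² / ‖z‖²`, `z_e` one of the coordinates of `z`
(`IsUniformStiefel.measure_mul_measure_univ`). The Gaussian measure of the corresponding cone gives

* over `ℂ`, `P (‖α‖² < s) = 1 - (1 - s)^k ≤ k s`
  (`IsUniformStiefel.measure_coeffSq_lt_complex`);
* over `ℝ`, `P (|α| < σ) ≤ 2 E‖z'‖ / √π · σ / √(1 - σ²)`, `z'` Gaussian in `ℝ^k` with density
  proportional to `exp (-‖z'‖²)`. Since `E‖z'‖ < (E‖z'‖²)^(1/2) = √(k/2)` strictly, this is at most
  `√(2k/π) σ` for small `σ` (`exists_measure_coeffSq_lt_le_real`).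

For independent nonnegative variables with distribution functions at most `c s` for `s ≤ s₀`,
integration of `P (a < t / b)` over `b` yields `P (a b < t) ≤ c² t log (1 / t) + O(t)`, sharpened to
`c² t (1 - log (c² t))` if `s₀ = 1 / c` (`measure_prod_mul_lt_le`). This is applied to `‖α‖²`, `‖β‖²`
with `c = k` over `ℂ`, and to `|α|`, `|β|` with `c = √(2k/π)` over `ℝ`.
-/

namespace SingularPencil

/-! ### Matrices with orthonormal columns -/

section Algebra

variable {𝕜 : Type*} [RCLike 𝕜] {κ ι ν : Type*} [Fintype κ] [Fintype ι]
  [DecidableEq ι] [Fintype ν]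

theorem orthonormal_columns {X : Matrix ν ι 𝕜} (hX : X ∈ stiefel 𝕜 ν ι) :
    Orthonormal 𝕜 fun j => (WithLp.toLp 2 fun i => X i j : EuclideanSpace 𝕜 ν) := by
  rw [orthonormal_iff_ite]
  intro i j
  have h : (Xᴴ * X) i j = (1 : Matrix ι ι 𝕜) i j := by rw [show Xᴴ * X = 1 from hX]
  simp only [Matrix.mul_apply, Matrix.conjTranspose_apply, Matrix.one_apply] at h
  rw [← h]
  simp [PiLp.inner_apply, mul_comm]

theorem mul_unitary_mem_stiefel {X : Matrix ν ι 𝕜} (hX : X ∈ stiefel 𝕜 ν ι) {W : Matrix ι ι 𝕜}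
    (hW : W ∈ Matrix.unitaryGroup ι 𝕜) : X * W ∈ stiefel 𝕜 ν ι := by
  change _ = _
  rw [Matrix.conjTranspose_mul, Matrix.mul_assoc, ← Matrix.mul_assoc Xᴴ,
    show Xᴴ * X = 1 from hX, Matrix.one_mul]
  exact Matrix.mem_unitaryGroup_iff'.1 hW

theorem submatrix_inl_mem_stiefel {X : Matrix ν (ι ⊕ Unit) 𝕜}
    (hX : X ∈ stiefel 𝕜 ν (ι ⊕ Unit)) : X.submatrix id Sum.inl ∈ stiefel 𝕜 ν ι := by
  change _ = _
  have h : (X.submatrix id Sum.inl)ᴴ * X.submatrix id Sum.inl =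
      (Xᴴ * X).submatrix Sum.inl Sum.inl := rfl
  rw [h, show Xᴴ * X = 1 from hX]
  exact Matrix.submatrix_one _ Sum.inl_injective

variable [DecidableEq ν]

theorem exists_unitary_submatrix_eq {X : Matrix ν ι 𝕜} (hX : X ∈ stiefel 𝕜 ν ι) {f : ι → ν}
    (hf : Function.Injective f) : ∃ B ∈ Matrix.unitaryGroup ν 𝕜, X = B.submatrix id f := by
  classical
  set v : ν → EuclideanSpace 𝕜 ν :=
    Function.extend f (fun j => WithLp.toLp 2 fun i => X i j) 0 with hv
  have hvf : ∀ j, v (f j) = WithLp.toLp 2 fun i => X i j := fun j => hf.extend_apply _ _ j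
  have ho : Orthonormal 𝕜 ((Set.range f).domRestrict v) := by
    have h1 := (orthonormal_columns hX).comp _ (Equiv.ofInjective f hf).symm.injective
    convert! h1 using 1
    funext ⟨_, j, rfl⟩
    simp [Set.domRestrict, hvf, Equiv.ofInjective_symm_apply]
  obtain ⟨b, hb⟩ := ho.exists_orthonormalBasis_extension_of_card_eq (by simp)
  refine ⟨Matrix.of fun i j => b j i, ?_, ?_⟩
  · rw [Matrix.mem_unitaryGroup_iff', Matrix.star_eq_conjTranspose]
    ext i j
    have h := orthonormal_iff_ite.1 b.orthonormal i j
    simp only [PiLp.inner_apply] at h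
    simpa [Matrix.mul_apply, Matrix.one_apply, mul_comm] using h
  · ext i j
    simp [hb (f j) ⟨j, rfl⟩, hvf]

/-- The unitary group acts transitively on the matrices with orthonormal columns. -/
theorem exists_unitary_mul_eq {X Q : Matrix ν ι 𝕜} (hX : X ∈ stiefel 𝕜 ν ι)
    (hQ : Q ∈ stiefel 𝕜 ν ι) : ∃ W ∈ Matrix.unitaryGroup ν 𝕜, W * X = Q := by
  have hc : Fintype.card ι ≤ Fintype.card ν := by
    simpa using (orthonormal_columns hX).linearIndependent.fintype_card_le_finrank
  obtain ⟨f⟩ := Function.Embedding.nonempty_of_card_le hc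
  obtain ⟨B, hB, rfl⟩ := exists_unitary_submatrix_eq hX f.injective
  obtain ⟨D, hD, rfl⟩ := exists_unitary_submatrix_eq hQ f.injective
  refine ⟨D * star B, mul_mem hD (Unitary.star_mem hB), ?_⟩
  have h : (star B * B.submatrix id f) = (1 : Matrix ν ν 𝕜).submatrix id f := by
    rw [← Matrix.mem_unitaryGroup_iff'.1 hB]
    rfl
  rw [Matrix.mul_assoc, h]
  ext i j
  simp [Matrix.mul_apply, Matrix.one_apply]

/-- A matrix of full column rank is the product of a matrix with orthonormal columns and a square
matrix. -/
theorem exists_stiefel_mul_eq {n k : ℕ} {G : Matrix (Fin n) (Fin k) 𝕜}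
    (hG : Function.Injective G.mulVec) :
    ∃ Q ∈ stiefel 𝕜 (Fin n) (Fin k), ∃ R : Matrix (Fin k) (Fin k) 𝕜, Q * R = G := by
  obtain ⟨L, hLG⟩ : ∃ L : EuclideanSpace 𝕜 (Fin k) →ₗ[𝕜] EuclideanSpace 𝕜 (Fin n),
    L = Matrix.toEuclideanLin G := ⟨_, rfl⟩
  have hL : Function.Injective L := by
    intro u v huv
    have := congrArg WithLp.ofLp huv
    exact WithLp.ofLp_injective 2 (hG (by simpa [hLG, Matrix.toLpLin_apply] using this))
  have hdim : Module.finrank 𝕜 (LinearMap.range L) = k := by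
    rw [LinearMap.finrank_range_of_inj hL, finrank_euclideanSpace_fin]
  obtain ⟨b⟩ : Nonempty (OrthonormalBasis (Fin k) 𝕜 (LinearMap.range L)) :=
    ⟨(stdOrthonormalBasis 𝕜 (LinearMap.range L)).reindex (finCongr hdim)⟩
  have hw : ∀ j, ∃ w : LinearMap.range L, ∀ i, (w : EuclideanSpace 𝕜 (Fin n)) i = G i j := by
    intro j
    refine ⟨⟨L (EuclideanSpace.single j 1), LinearMap.mem_range_self _ _⟩, fun i => ?_⟩
    simp [hLG, Matrix.toLpLin_apply]
  choose w hw using hw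
  refine ⟨Matrix.of fun i j => (b j : EuclideanSpace 𝕜 (Fin n)) i, ?_,
    Matrix.of fun a j => b.repr (w j) a, ?_⟩
  · change _ = _
    ext i j
    have h := orthonormal_iff_ite.1 b.orthonormal i j
    rw [Submodule.coe_inner] at h
    simp only [PiLp.inner_apply] at h
    simpa [Matrix.mul_apply, Matrix.one_apply, mul_comm] using h
  · ext i j
    have h := congrArg (fun y : LinearMap.range L => (y : EuclideanSpace 𝕜 (Fin n)) i)
      (b.sum_repr (w j))
    simp only [Submodule.coe_sum, Submodule.coe_smul, WithLp.ofLp_sum, WithLp.ofLp_smul,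
      Finset.sum_apply, Pi.smul_apply, smul_eq_mul, hw] at h
    rw [← h]
    simp [Matrix.mul_apply, mul_comm]

theorem exists_unitary_mulVec_eq {z w : ν → 𝕜} (hz : star z ⬝ᵥ z = 1) (hw : star w ⬝ᵥ w = 1) :
    ∃ W ∈ Matrix.unitaryGroup ν 𝕜, W *ᵥ z = w := by
  have key : ∀ u : ν → 𝕜, star u ⬝ᵥ u = 1 →
      Matrix.replicateCol Unit u ∈ stiefel 𝕜 ν Unit := by
    intro u hu
    change _ = _
    ext i j
    simpa [Matrix.mul_apply, dotProduct] using hu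
  obtain ⟨W, hW, h⟩ := exists_unitary_mul_eq (key z hz) (key w hw)
  refine ⟨W, hW, ?_⟩
  ext i
  have := congrFun (congrFun h i) ()
  simpa [Matrix.mul_apply, Matrix.mulVec, dotProduct] using this

theorem exists_unit_mulVec_eq_zero (M : Matrix κ (κ ⊕ Unit) 𝕜) :
    ∃ c, star c ⬝ᵥ c = 1 ∧ M *ᵥ c = 0 := by
  have hk : LinearMap.ker M.mulVecLin ≠ ⊥ :=
    LinearMap.ker_ne_bot_of_finrank_lt (by simp)
  obtain ⟨v, hv, hv0⟩ := (Submodule.ne_bot_iff _).1 hk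
  have hv' : M *ᵥ v = 0 := hv
  set u : EuclideanSpace 𝕜 (κ ⊕ Unit) := WithLp.toLp 2 v
  have hu : u ≠ 0 := fun h => hv0 (by simpa [u] using h)
  have hu1 : ‖((‖u‖ : 𝕜)⁻¹) • u‖ = 1 := norm_smul_inv_norm hu
  refine ⟨((‖u‖ : 𝕜)⁻¹) • v, ?_, ?_⟩
  · have h2 := inner_self_eq_norm_sq_to_K (𝕜 := 𝕜) (((‖u‖ : 𝕜)⁻¹) • u)
    rw [hu1, EuclideanSpace.inner_eq_star_dotProduct] at h2
    rw [dotProduct_comm]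
    simpa [u] using h2
  · rw [Matrix.mulVec_smul, hv', smul_zero]

variable [DecidableEq κ]

/-- The orthogonal projection `1 - Mᴴ (M Mᴴ)⁻¹ M` onto the kernel of a matrix `M` of full row
rank. (If `M` does not have full row rank, the inverse is the junk value `0`.) -/
noncomputable def kerProj (M : Matrix κ ι 𝕜) : Matrix ι ι 𝕜 :=
  1 - Mᴴ * (M * Mᴴ)⁻¹ * M

theorem kerProj_mul_unitary (M : Matrix κ ι 𝕜) {W : Matrix ι ι 𝕜}
    (hW : W ∈ Matrix.unitaryGroup ι 𝕜) : kerProj (M * W) = Wᴴ * kerProj M * W := by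
  have h1 : W * Wᴴ = 1 := Matrix.mem_unitaryGroup_iff.1 hW
  have h2 : Wᴴ * W = 1 := Matrix.mem_unitaryGroup_iff'.1 hW
  have h3 : M * W * (M * W)ᴴ = M * Mᴴ := by
    rw [Matrix.conjTranspose_mul, Matrix.mul_assoc, ← Matrix.mul_assoc W, h1, Matrix.one_mul]
  rw [kerProj, h3, kerProj, Matrix.mul_sub, Matrix.sub_mul, Matrix.mul_one, h2,
    Matrix.conjTranspose_mul]
  simp only [Matrix.mul_assoc]

/-- If the kernel of `M` is one-dimensional, the projection onto it is `c cᴴ` for a unit vector `c`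
of the kernel. -/
theorem kerProj_eq_vecMulVec {M : Matrix κ (κ ⊕ Unit) 𝕜} (hM : (M * Mᴴ).det ≠ 0)
    {c : κ ⊕ Unit → 𝕜} (hc : star c ⬝ᵥ c = 1) (hMc : M *ᵥ c = 0) :
    kerProj M = Matrix.vecMulVec c (star c) := by
  have hu : IsUnit (M * Mᴴ).det := isUnit_iff_ne_zero.2 hM
  -- The square matrix with the rows of `M` and `cᴴ` has a right inverse, which then is a left
  -- inverse as well.
  set T : Matrix (κ ⊕ Unit) (κ ⊕ Unit) 𝕜 := Matrix.fromRows M (Matrix.replicateRow Unit (star c))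
  set R : Matrix (κ ⊕ Unit) (κ ⊕ Unit) 𝕜 :=
    Matrix.fromCols (Mᴴ * (M * Mᴴ)⁻¹) (Matrix.replicateCol Unit c)
  have hTR : T * R = 1 := by
    rw [Matrix.fromRows_mul_fromCols, ← Matrix.fromBlocks_one]
    congr 1
    · rw [← Matrix.mul_assoc, Matrix.mul_nonsing_inv _ hu]
    · rw [← Matrix.replicateCol_mulVec, hMc]; rfl
    · rw [← Matrix.mul_assoc]
      have : Matrix.replicateRow Unit (star c) * Mᴴ = 0 := by
        rw [← Matrix.replicateRow_vecMul, ← Matrix.star_mulVec, hMc, star_zero]; rfl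
      rw [this, Matrix.zero_mul]
    · ext i j
      simpa [Matrix.mul_apply, dotProduct] using hc
  have hRT : R * T = 1 := mul_eq_one_comm.1 hTR
  rw [Matrix.fromCols_mul_fromRows] at hRT
  rw [kerProj, ← hRT, add_sub_cancel_left, Matrix.vecMulVec_eq Unit]

open ComplexOrder in
theorem det_mul_conjTranspose_ne_zero {M : Matrix κ (κ ⊕ Unit) 𝕜}
    (hM : (M.submatrix id Sum.inl).det ≠ 0) : (M * Mᴴ).det ≠ 0 := by
  intro h
  obtain ⟨v, hv, hv0⟩ := Matrix.exists_vecMul_eq_zero_iff.2 h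
  have h1 : v ᵥ* M = 0 := (Matrix.vecMul_self_mul_conjTranspose_eq_zero M v).1 hv0
  refine hM (Matrix.exists_vecMul_eq_zero_iff.1 ⟨v, hv, ?_⟩)
  ext j
  exact congrFun h1 (Sum.inl j)

end Algebra

/-! ### The uniform distribution on the Stiefel manifold -/

section Stiefel

variable {𝕜 : Type*} [RCLike 𝕜] [MeasurableSpace 𝕜] [BorelSpace 𝕜]

/-- The entrywise sigma-algebra is the Borel sigma-algebra of the entrywise topology. -/
instance matrix_borelSpace {m n : Type*} [Countable m] [Countable n] :
    BorelSpace (Matrix m n 𝕜) :=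
  inferInstanceAs (BorelSpace (m → n → 𝕜))

instance matrix_secondCountableTopology {m n : Type*} [Countable m] [Countable n] :
    SecondCountableTopology (Matrix m n 𝕜) :=
  inferInstanceAs (SecondCountableTopology (m → n → 𝕜))

theorem ae_addHaar_det_conjTranspose_mul_ne_zero {n k : ℕ} {V : Matrix (Fin n) (Fin k) 𝕜}
    (hV : V ∈ stiefel 𝕜 (Fin n) (Fin k)) :
    ∀ᵐ G ∂(Measure.addHaar : Measure (Fin n → Fin k → 𝕜)), (Vᴴ * Matrix.of G).det ≠ 0 := by
  set m : Measure (Fin n → Fin k → 𝕜) := Measure.addHaar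
  set N : Set (Fin n → Fin k → 𝕜) := {G | (Vᴴ * Matrix.of G).det = 0}
  have hcont : Continuous fun G : Fin n → Fin k → 𝕜 => (Vᴴ * Matrix.of G).det := by
    have : Continuous fun G : Fin n → Fin k → 𝕜 => (Matrix.of G : Matrix _ _ 𝕜) := continuous_id
    fun_prop
  have hN : MeasurableSet N := (isClosed_singleton.preimage hcont).measurableSet
  -- On each line `G + t V`, the determinant is a monic polynomial in `t`.
  let sh : (Fin n → Fin k → 𝕜) × ℝ → (Fin n → Fin k → 𝕜) :=
    fun p => p.1 + fun i j => (p.2 : 𝕜) * V i j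
  have hsh : Continuous sh := by
    refine continuous_pi fun i => continuous_pi fun j => ?_
    have h1 : Continuous fun p : (Fin n → Fin k → 𝕜) × ℝ => p.1 i j := by fun_prop
    have h2 : Continuous fun p : (Fin n → Fin k → 𝕜) × ℝ => ((p.2 : ℝ) : 𝕜) :=
      RCLike.continuous_ofReal.comp continuous_snd
    exact h1.add (h2.mul continuous_const)
  have hS : MeasurableSet (sh ⁻¹' N) := hsh.measurable hN
  have hline : ∀ G, (volume : Measure ℝ) (Prod.mk G ⁻¹' (sh ⁻¹' N)) = 0 := by
    intro G
    have hfin : {x : 𝕜 | (-(Vᴴ * Matrix.of G)).charpoly.IsRoot x}.Finite :=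
      Polynomial.finite_setOfPred_isRoot (Matrix.charpoly_monic _).ne_zero
    refine (Set.Finite.subset (hfin.preimage
      (RCLike.ofReal_injective (K := 𝕜)).injOn) ?_).measure_zero _
    intro t ht
    have ht' : (Vᴴ * Matrix.of (G + fun i j => (t : 𝕜) * V i j)).det = 0 := ht
    have he : Vᴴ * Matrix.of (G + fun i j => (t : 𝕜) * V i j) =
        Matrix.scalar (Fin k) (t : 𝕜) - -(Vᴴ * Matrix.of G) := by
      have h1 : (Matrix.of (G + fun i j => (t : 𝕜) * V i j) : Matrix (Fin n) (Fin k) 𝕜) =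
        Matrix.of G + (t : 𝕜) • V := rfl
      rw [h1, Matrix.mul_add, Matrix.mul_smul, show Vᴴ * V = 1 from hV, sub_neg_eq_add, add_comm]
      congr 1
      ext i j
      simp [Matrix.one_apply, Matrix.diagonal_apply]
    simp only [Set.mem_preimage, Set.mem_ofPred_eq, Polynomial.IsRoot, Matrix.eval_charpoly]
    rw [← he, ht']
  have hprod : (m.prod volume) (sh ⁻¹' N) = 0 := by
    rw [Measure.measure_prod_null hS]
    exact Filter.Eventually.of_forall hline
  have htr : ∀ t : ℝ, m ((fun G => (G, t)) ⁻¹' (sh ⁻¹' N)) = m N := by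
    intro t
    exact measure_preimage_add_right m (fun i j => (t : 𝕜) * V i j) N
  rw [Measure.prod_apply_symm hS] at hprod
  simp only [htr, lintegral_const, Real.volume_univ] at hprod
  rw [mul_eq_zero, or_iff_left ENNReal.top_ne_zero] at hprod
  exact measure_eq_zero_iff_ae_notMem.1 hprod

/-- The fixed subspace `ran X` and the random subspace `ker Vᴴ`, of complementary dimensions, almost
surely have trivial intersection. For the fixed subspace replaced by the range of
a generic matrix `G` this follows from Fubini's theorem, and that range is the image of the given
subspace under a unitary map. -/
theorem IsUniformStiefel.ae_det_ne_zero {n k : ℕ} {ν : Measure (Matrix (Fin n) (Fin k) 𝕜)}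
    (hν : IsUniformStiefel ν) {X : Matrix (Fin n) (Fin k) 𝕜}
    (hX : X ∈ stiefel 𝕜 (Fin n) (Fin k)) : ∀ᵐ V ∂ν, (Vᴴ * X).det ≠ 0 := by
  have := hν.isProbabilityMeasure
  set m : Measure (Fin n → Fin k → 𝕜) := Measure.addHaar
  have hcont : Continuous fun p : Matrix (Fin n) (Fin k) 𝕜 × (Fin n → Fin k → 𝕜) =>
      (p.1ᴴ * Matrix.of p.2).det := by
    have : Continuous fun p : Matrix (Fin n) (Fin k) 𝕜 × (Fin n → Fin k → 𝕜) =>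
      (Matrix.of p.2 : Matrix _ _ 𝕜) := continuous_snd
    fun_prop
  have hS : MeasurableSet {p : Matrix (Fin n) (Fin k) 𝕜 × (Fin n → Fin k → 𝕜) |
      (p.1ᴴ * Matrix.of p.2).det ≠ 0} :=
    (isOpen_ne.preimage hcont).measurableSet
  have h2 : ∀ᵐ G ∂m, ∀ᵐ V ∂ν, (Vᴴ * Matrix.of G).det ≠ 0 := by
    refine (Measure.ae_ae_comm hS).1 ?_
    filter_upwards [hν.ae_mem] with V hV using ae_addHaar_det_conjTranspose_mul_ne_zero hV
  obtain ⟨G, hG⟩ := h2.exists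
  have hinj : Function.Injective (Matrix.of G : Matrix (Fin n) (Fin k) 𝕜).mulVec := by
    obtain ⟨V, hV⟩ := hG.exists
    intro u v huv
    refine Matrix.mulVec_injective_iff_isUnit.2 ((Matrix.isUnit_iff_isUnit_det _).2
      (isUnit_iff_ne_zero.2 hV)) ?_
    have := congrArg (Vᴴ *ᵥ ·) huv
    simpa [Matrix.mulVec_mulVec] using this
  obtain ⟨Q, hQ, R, hQR⟩ := exists_stiefel_mul_eq hinj
  obtain ⟨W, hW, hWX⟩ := exists_unitary_mul_eq hQ hX
  have hmeas : Measurable fun V : Matrix (Fin n) (Fin k) 𝕜 => W * V :=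
    (continuous_const.matrix_mul continuous_id).measurable
  rw [← hν.map_unitary_mul W hW]
  have hS' : MeasurableSet {V : Matrix (Fin n) (Fin k) 𝕜 | (Vᴴ * X).det ≠ 0} := by
    have : Continuous fun V : Matrix (Fin n) (Fin k) 𝕜 => (Vᴴ * X).det := by fun_prop
    exact (isOpen_ne.preimage this).measurableSet
  rw [ae_map_iff hmeas.aemeasurable hS']
  filter_upwards [hG] with V hV
  have h3 : (W * V)ᴴ * X = Vᴴ * Q := by
    rw [← hWX, Matrix.conjTranspose_mul, Matrix.mul_assoc, ← Matrix.mul_assoc Wᴴ,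
      show Wᴴ * W = 1 from Matrix.mem_unitaryGroup_iff'.1 hW, Matrix.one_mul]
  rw [h3]
  intro h0
  apply hV
  rw [← hQR, ← Matrix.mul_assoc, Matrix.det_mul, h0, zero_mul]

end Stiefel

/-! ### The law of the coefficient -/

section Law

variable {𝕜 : Type*} [RCLike 𝕜]

theorem star_dotProduct_self_eq {ι : Type*} [Fintype ι] (z : ι → 𝕜) :
    star z ⬝ᵥ z = ((∑ i, ‖z i‖ ^ 2 : ℝ) : 𝕜) := by
  simp [dotProduct, RCLike.conj_mul]

theorem star_dotProduct_mulVec_unitary {ι : Type*} [Fintype ι] [DecidableEq ι] {W : Matrix ι ι 𝕜}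
    (hW : W ∈ Matrix.unitaryGroup ι 𝕜) (z w : ι → 𝕜) :
    star (W *ᵥ z) ⬝ᵥ (W *ᵥ w) = star z ⬝ᵥ w := by
  rw [Matrix.star_mulVec, Matrix.dotProduct_mulVec, Matrix.vecMul_vecMul,
    show Wᴴ * W = 1 from Matrix.mem_unitaryGroup_iff'.1 hW, Matrix.vecMul_one]

theorem sum_norm_sq_mulVec_unitary {ι : Type*} [Fintype ι] [DecidableEq ι] {W : Matrix ι ι 𝕜}
    (hW : W ∈ Matrix.unitaryGroup ι 𝕜) (z : ι → 𝕜) :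
    ∑ i, ‖(W *ᵥ z) i‖ ^ 2 = ∑ i, ‖z i‖ ^ 2 := by
  have h := star_dotProduct_mulVec_unitary hW z z
  rw [star_dotProduct_self_eq, star_dotProduct_self_eq] at h
  exact_mod_cast h

variable {n k : ℕ}

/-- The squared modulus of the component along `z` of the unit vectors in the kernel of `Vᴴ X`, as a
measurable function of `V` (for unit vectors `z`, and almost every `V`). -/
noncomputable def coeffSq (X : Matrix (Fin n) (Fin k ⊕ Unit) 𝕜) (V : Matrix (Fin n) (Fin k) 𝕜)
    (z : Fin k ⊕ Unit → 𝕜) : ℝ :=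
  RCLike.re (star z ⬝ᵥ kerProj (Vᴴ * X) *ᵥ z)

/-- The coordinate vector of the last of the `k + 1` columns. -/
def lastVec (𝕜 : Type*) [RCLike 𝕜] (k : ℕ) : Fin k ⊕ Unit → 𝕜 := Pi.single (Sum.inr ()) 1

theorem star_lastVec_dotProduct (z : Fin k ⊕ Unit → 𝕜) :
    star (lastVec 𝕜 k) ⬝ᵥ z = z (Sum.inr ()) := by
  simp [lastVec]

theorem coeffSq_eq {X : Matrix (Fin n) (Fin k ⊕ Unit) 𝕜} {V : Matrix (Fin n) (Fin k) 𝕜}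
    (hV : (Vᴴ * X.submatrix id Sum.inl).det ≠ 0) {c : Fin k ⊕ Unit → 𝕜}
    (hc : star c ⬝ᵥ c = 1) (hVc : (Vᴴ * X) *ᵥ c = 0) (z : Fin k ⊕ Unit → 𝕜) :
    coeffSq X V z = ‖star c ⬝ᵥ z‖ ^ 2 := by
  have hdet : ((Vᴴ * X) * (Vᴴ * X)ᴴ).det ≠ 0 := det_mul_conjTranspose_ne_zero hV
  rw [coeffSq, kerProj_eq_vecMulVec hdet hc hVc, Matrix.vecMulVec_mulVec]
  have h : star z ⬝ᵥ c = star (star c ⬝ᵥ z) := by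
    rw [Matrix.star_dotProduct]
  have h2 : star z ⬝ᵥ (MulOpposite.op (star c ⬝ᵥ z) • c) =
      (star z ⬝ᵥ c) * (star c ⬝ᵥ z) := by
    rw [dotProduct_smul]
    simp
  rw [h2, h, RCLike.star_def, RCLike.conj_mul]
  norm_cast

theorem coeffSq_smul (X : Matrix (Fin n) (Fin k ⊕ Unit) 𝕜) (V : Matrix (Fin n) (Fin k) 𝕜)
    (r : ℝ) (z : Fin k ⊕ Unit → 𝕜) : coeffSq X V ((r : 𝕜) • z) = r ^ 2 * coeffSq X V z := by
  rw [coeffSq, Matrix.mulVec_smul, star_smul, smul_dotProduct, dotProduct_smul, coeffSq,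
    RCLike.star_def, RCLike.conj_ofReal, smul_eq_mul, smul_eq_mul, RCLike.re_ofReal_mul,
    RCLike.re_ofReal_mul]
  ring

theorem coeffSq_mulVec_unitary {X : Matrix (Fin n) (Fin k ⊕ Unit) 𝕜}
    {V W : Matrix (Fin n) (Fin k) 𝕜} {W' : Matrix (Fin k ⊕ Unit) (Fin k ⊕ Unit) 𝕜}
    (hW' : W' ∈ Matrix.unitaryGroup (Fin k ⊕ Unit) 𝕜) (h : Wᴴ * X = Vᴴ * X * W')
    (z : Fin k ⊕ Unit → 𝕜) : coeffSq X V (W' *ᵥ z) = coeffSq X W z := by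
  rw [coeffSq, coeffSq, h, kerProj_mul_unitary _ hW', Matrix.star_mulVec,
    ← Matrix.dotProduct_mulVec, Matrix.mulVec_mulVec, Matrix.mulVec_mulVec]

variable [MeasurableSpace 𝕜] [BorelSpace 𝕜]

theorem measurable_matrix_inv {κ : Type*} [Fintype κ] [DecidableEq κ] :
    Measurable fun A : Matrix κ κ 𝕜 => A⁻¹ := by
  have h1 : Measurable fun A : Matrix κ κ 𝕜 => (A.det)⁻¹ :=
    (continuous_id.matrix_det.measurable).inv
  have h2 : Continuous fun p : 𝕜 × Matrix κ κ 𝕜 => p.1 • p.2.adjugate :=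
    continuous_fst.smul continuous_snd.matrix_adjugate
  have h3 := h2.measurable.comp (h1.prodMk measurable_id)
  convert! h3 using 2 with A
  simp [Matrix.inv_def, Ring.inverse_eq_inv']

theorem measurable_kerProj {κ ι : Type*} [Fintype κ] [DecidableEq κ] [Fintype ι] [DecidableEq ι] :
    Measurable (kerProj : Matrix κ ι 𝕜 → Matrix ι ι 𝕜) := by
  have h1 : Measurable fun M : Matrix κ ι 𝕜 => (M * Mᴴ)⁻¹ :=
    measurable_matrix_inv.comp
      (continuous_id.matrix_mul continuous_id.matrix_conjTranspose).measurable
  have h2 : Continuous fun p : Matrix κ ι 𝕜 × Matrix κ κ 𝕜 =>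
      (1 - p.1ᴴ * p.2 * p.1 : Matrix ι ι 𝕜) :=
    continuous_const.sub ((continuous_fst.matrix_conjTranspose.matrix_mul
      continuous_snd).matrix_mul continuous_fst)
  have h3 : Measurable fun M : Matrix κ ι 𝕜 => (M, (M * Mᴴ)⁻¹) := measurable_id.prodMk h1
  have h4 := h2.measurable
  have h5 := h4.comp h3
  exact h5

theorem measurable_coeffSq (X : Matrix (Fin n) (Fin k ⊕ Unit) 𝕜) :
    Measurable fun p : (Fin k ⊕ Unit → 𝕜) × Matrix (Fin n) (Fin k) 𝕜 => coeffSq X p.2 p.1 := by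
  have h1 : Measurable fun V : Matrix (Fin n) (Fin k) 𝕜 => kerProj (Vᴴ * X) := by
    refine measurable_kerProj.comp (Continuous.measurable ?_)
    fun_prop
  have h2 : Continuous fun p : (Fin k ⊕ Unit → 𝕜) × Matrix (Fin k ⊕ Unit) (Fin k ⊕ Unit) 𝕜 =>
      RCLike.re (star p.1 ⬝ᵥ p.2 *ᵥ p.1) :=
    RCLike.continuous_re.comp
      (Continuous.dotProduct continuous_fst.star
        (Continuous.matrix_mulVec continuous_snd continuous_fst))
  exact h2.measurable.comp (measurable_fst.prodMk (h1.comp measurable_snd))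

theorem measurable_coeffSq_left (X : Matrix (Fin n) (Fin k ⊕ Unit) 𝕜) (z : Fin k ⊕ Unit → 𝕜) :
    Measurable fun V => coeffSq X V z :=
  (measurable_coeffSq X).comp (measurable_const.prodMk measurable_id)

/-- The law of the component along a unit vector does not depend on the unit vector: a unitary map
of the coefficient space extends, through `X`, to a unitary map of the whole space. -/
theorem IsUniformStiefel.measure_coeffSq_lt {ν : Measure (Matrix (Fin n) (Fin k) 𝕜)}
    (hν : IsUniformStiefel ν) {X : Matrix (Fin n) (Fin k ⊕ Unit) 𝕜}
    (hX : X ∈ stiefel 𝕜 (Fin n) (Fin k ⊕ Unit)) (s : ℝ) {z : Fin k ⊕ Unit → 𝕜} (hz : z ≠ 0) :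
    ν {V | coeffSq X V z < s * ∑ i, ‖z i‖ ^ 2} = ν {V | coeffSq X V (lastVec 𝕜 k) < s} := by
  set N : ℝ := ∑ i, ‖z i‖ ^ 2 with hN
  have hNpos : 0 < N := by
    obtain ⟨i, hi⟩ := Function.ne_iff.1 hz
    exact Finset.sum_pos' (fun i _ => by positivity)
      ⟨i, Finset.mem_univ i, by have := norm_pos_iff.2 hi; positivity⟩
  set r : ℝ := √N
  have hr : 0 < r := Real.sqrt_pos.2 hNpos
  have hr2 : r ^ 2 = N := Real.sq_sqrt hNpos.le
  set u : Fin k ⊕ Unit → 𝕜 := ((r⁻¹ : ℝ) : 𝕜) • z with hu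
  have hzu : z = (r : 𝕜) • u := by
    rw [hu, smul_smul, ← RCLike.ofReal_mul, mul_inv_cancel₀ hr.ne', RCLike.ofReal_one, one_smul]
  have hu1 : star u ⬝ᵥ u = 1 := by
    rw [hu, star_smul, smul_dotProduct, dotProduct_smul, star_dotProduct_self_eq, RCLike.star_def,
      RCLike.conj_ofReal, smul_eq_mul, smul_eq_mul, ← hN, ← hr2]
    norm_cast
    field_simp
  have he : star (lastVec 𝕜 k) ⬝ᵥ lastVec 𝕜 k = 1 := by
    rw [star_lastVec_dotProduct]; simp [lastVec]
  obtain ⟨W', hW', hWe⟩ := exists_unitary_mulVec_eq he hu1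
  obtain ⟨W, hW, hWX⟩ := exists_unitary_mul_eq hX (mul_unitary_mem_stiefel hX hW')
  have hmeas : Measurable fun V : Matrix (Fin n) (Fin k) 𝕜 => Wᴴ * V :=
    (continuous_const.matrix_mul continuous_id).measurable
  have hset : {V : Matrix (Fin n) (Fin k) 𝕜 | coeffSq X V z < s * N} =
      (fun V => Wᴴ * V) ⁻¹' {V | coeffSq X V (lastVec 𝕜 k) < s} := by
    ext V
    have h1 : (Wᴴ * V)ᴴ * X = Vᴴ * X * W' := by
      rw [Matrix.conjTranspose_mul, Matrix.conjTranspose_conjTranspose, Matrix.mul_assoc, hWX,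
        Matrix.mul_assoc]
    simp only [Set.mem_ofPred_eq, Set.mem_preimage]
    rw [hzu, coeffSq_smul, hr2, ← hWe, coeffSq_mulVec_unitary hW' h1, mul_comm s,
      mul_lt_mul_iff_right₀ hNpos]
  rw [hset, ← Measure.map_apply hmeas
    (measurableSet_lt (measurable_coeffSq_left X _) measurable_const),
    show ν.map (fun V => Wᴴ * V) = ν from hν.map_unitary_mul _ (Unitary.star_mem hW)]

/-- The squared modulus of a coordinate of a uniformly distributed unit vector has the same law as
`|z_e|² / ‖z‖²` under any rotation invariant measure `ρ`, normalized to be a probability measure. -/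
theorem IsUniformStiefel.measure_mul_measure_univ {ν : Measure (Matrix (Fin n) (Fin k) 𝕜)}
    (hν : IsUniformStiefel ν) {X : Matrix (Fin n) (Fin k ⊕ Unit) 𝕜}
    (hX : X ∈ stiefel 𝕜 (Fin n) (Fin k ⊕ Unit)) {ρ : Measure (Fin k ⊕ Unit → 𝕜)} [SFinite ρ]
    (hρ : ∀ W ∈ Matrix.unitaryGroup (Fin k ⊕ Unit) 𝕜, ρ.map (W *ᵥ ·) = ρ) (hρ0 : ρ {0} = 0)
    (s : ℝ) :
    ν {V | coeffSq X V (lastVec 𝕜 k) < s} * ρ Set.univ =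
      ρ {z | ‖z (Sum.inr ())‖ ^ 2 < s * ∑ i, ‖z i‖ ^ 2} := by
  have := hν.isProbabilityMeasure
  have hnorm : Measurable fun z : Fin k ⊕ Unit → 𝕜 => ∑ i, ‖z i‖ ^ 2 := by fun_prop
  set T : Set ((Fin k ⊕ Unit → 𝕜) × Matrix (Fin n) (Fin k) 𝕜) :=
    {p | coeffSq X p.2 p.1 < s * ∑ i, ‖p.1 i‖ ^ 2} with hTdef
  have hT : MeasurableSet T :=
    measurableSet_lt (measurable_coeffSq X) ((hnorm.comp measurable_fst).const_mul s)
  have hC : MeasurableSet {z : Fin k ⊕ Unit → 𝕜 | ‖z (Sum.inr ())‖ ^ 2 < s * ∑ i, ‖z i‖ ^ 2} :=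
    measurableSet_lt (by fun_prop) (hnorm.const_mul s)
  have h1 : (ρ.prod ν) T = ν {V | coeffSq X V (lastVec 𝕜 k) < s} * ρ Set.univ := by
    rw [Measure.prod_apply hT, ← lintegral_const]
    refine lintegral_congr_ae ?_
    have : ∀ᵐ z ∂ρ, z ≠ 0 := measure_eq_zero_iff_ae_notMem.1 hρ0
    filter_upwards [this] with z hz using hν.measure_coeffSq_lt hX s hz
  have h2 : (ρ.prod ν) T = ρ {z | ‖z (Sum.inr ())‖ ^ 2 < s * ∑ i, ‖z i‖ ^ 2} := by
    rw [Measure.prod_apply_symm hT]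
    have : ∀ᵐ V ∂ν, ρ ((fun z => (z, V)) ⁻¹' T) =
        ρ {z | ‖z (Sum.inr ())‖ ^ 2 < s * ∑ i, ‖z i‖ ^ 2} := by
      filter_upwards [hν.ae_det_ne_zero (submatrix_inl_mem_stiefel hX)] with V hV
      obtain ⟨c, hc, hVc⟩ := exists_unit_mulVec_eq_zero (Vᴴ * X)
      have he : star (lastVec 𝕜 k) ⬝ᵥ lastVec 𝕜 k = 1 := by
        rw [star_lastVec_dotProduct]; simp [lastVec]
      obtain ⟨W, hW, hWc⟩ := exists_unitary_mulVec_eq hc he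
      have hWm : Measurable fun z : Fin k ⊕ Unit → 𝕜 => W *ᵥ z :=
        (Continuous.matrix_mulVec continuous_const continuous_id).measurable
      have hset : (fun z => (z, V)) ⁻¹' T =
          (W *ᵥ ·) ⁻¹' {z | ‖z (Sum.inr ())‖ ^ 2 < s * ∑ i, ‖z i‖ ^ 2} := by
        ext z
        simp only [hTdef, Set.mem_preimage, Set.mem_ofPred_eq]
        rw [coeffSq_eq hV hc hVc, sum_norm_sq_mulVec_unitary hW, ← star_lastVec_dotProduct (W *ᵥ z),
          ← hWc, star_dotProduct_mulVec_unitary hW]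
      rw [hset, ← Measure.map_apply hWm hC, hρ W hW]
    rw [lintegral_congr_ae this, lintegral_const, measure_univ, mul_one]
  rw [← h1, h2]

end Law

/-! ### Rotation invariant Gaussian measures -/

section Radial

variable {𝕜 : Type*} [RCLike 𝕜] [MeasurableSpace 𝕜] [BorelSpace 𝕜] {ι : Type*} [Fintype ι]

theorem map_unitary_mulVec_addHaar [DecidableEq ι] (m : Measure (ι → 𝕜)) [m.IsAddHaarMeasure]
    {W : Matrix ι ι 𝕜} (hW : W ∈ Matrix.unitaryGroup ι 𝕜) : m.map (W *ᵥ ·) = m := by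
  have hW1 : W * star W = 1 := Matrix.mem_unitaryGroup_iff.1 hW
  have hW2 : star W * W = 1 := Matrix.mem_unitaryGroup_iff'.1 hW
  let L : (ι → 𝕜) ≃ₗ[ℝ] (ι → 𝕜) :=
    { toFun := fun z => W *ᵥ z
      invFun := fun z => star W *ᵥ z
      map_add' := Matrix.mulVec_add W
      map_smul' := fun r z => Matrix.mulVec_smul W r z
      left_inv := fun z => by
        change star W *ᵥ W *ᵥ z = z
        rw [Matrix.mulVec_mulVec, hW2, Matrix.one_mulVec]
      right_inv := fun z => by
        change W *ᵥ star W *ᵥ z = z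
        rw [Matrix.mulVec_mulVec, hW1, Matrix.one_mulVec] }
  have hc : Continuous fun z : ι → 𝕜 => W *ᵥ z :=
    Continuous.matrix_mulVec continuous_const continuous_id
  have hH : (m.map (W *ᵥ ·)).IsAddHaarMeasure :=
    L.toContinuousLinearEquiv.isAddHaarMeasure_map m
  obtain ⟨c, h⟩ : ∃ c : NNReal, m.map (W *ᵥ ·) = c • m :=
    ⟨_, Measure.isAddLeftInvariant_eq_smul _ m⟩
  -- The constant is found by evaluating both measures at the Euclidean unit ball.
  set B : Set (ι → 𝕜) := {z | ∑ i, ‖z i‖ ^ 2 < 1} with hB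
  have hBo : IsOpen B := isOpen_lt (by fun_prop) continuous_const
  have hpos : m B ≠ 0 := (hBo.measure_pos m ⟨0, by simp [hB]⟩).ne'
  have hfin : m B ≠ ⊤ := by
    refine ((measure_mono ?_).trans_lt
      (measure_closedBall_lt_top (μ := m) (x := 0) (r := 1))).ne
    intro z hz
    rw [mem_closedBall_zero_iff, pi_norm_le_iff_of_nonneg zero_le_one]
    intro i
    have h1 : ‖z i‖ ^ 2 ≤ ∑ j, ‖z j‖ ^ 2 :=
      Finset.single_le_sum (f := fun j => ‖z j‖ ^ 2) (fun j _ => by positivity) (Finset.mem_univ i)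
    have h2 : ∑ j, ‖z j‖ ^ 2 < 1 := hz
    exact (sq_le_one_iff₀ (norm_nonneg _)).1 (h1.trans h2.le)
  have hmB : (m.map (W *ᵥ ·)) B = m B := by
    rw [Measure.map_apply hc.measurable hBo.measurableSet]
    congr 1
    ext z
    simp only [hB, Set.mem_preimage, Set.mem_ofPred_eq, sum_norm_sq_mulVec_unitary hW]
  rw [h, Measure.smul_apply, ENNReal.smul_def, smul_eq_mul] at hmB
  have hc1 : c = 1 := by
    rw [ENNReal.mul_eq_right hpos hfin] at hmB
    exact_mod_cast hmB
  rw [h, hc1, one_smul]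

/-- The measure with density `exp (-‖z‖²)`, `‖z‖` the Euclidean norm, with respect to `m`. -/
noncomputable def gaussianMeasure (m : Measure (ι → 𝕜)) : Measure (ι → 𝕜) :=
  m.withDensity fun z => ENNReal.ofReal (Real.exp (-∑ i, ‖z i‖ ^ 2))

theorem map_unitary_mulVec_gaussianMeasure [DecidableEq ι] (m : Measure (ι → 𝕜))
    [m.IsAddHaarMeasure] {W : Matrix ι ι 𝕜} (hW : W ∈ Matrix.unitaryGroup ι 𝕜) :
    (gaussianMeasure m).map (W *ᵥ ·) = gaussianMeasure m := by
  have hc : Measurable fun z : ι → 𝕜 => W *ᵥ z :=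
    (Continuous.matrix_mulVec continuous_const continuous_id).measurable
  have hmp : MeasurePreserving (fun z : ι → 𝕜 => W *ᵥ z) m m :=
    ⟨hc, map_unitary_mulVec_addHaar m hW⟩
  ext S hS
  rw [Measure.map_apply hc hS, gaussianMeasure, withDensity_apply _ hS,
    withDensity_apply _ (hc hS), ← hmp.setLIntegral_comp_preimage hS (by fun_prop)]
  simp only [sum_norm_sq_mulVec_unitary hW]

end Radial

theorem lintegral_sum_unit {E : Type*} [MeasureSpace E] [SigmaFinite (volume : Measure E)] {k : ℕ}
    {F : (Fin k ⊕ Unit → E) → ENNReal} (hF : Measurable F) :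
    ∫⁻ z, F z = ∫⁻ z : Fin k → E, ∫⁻ w : E, F (Sum.elim z fun _ => w) := by
  have h1 := (volume_measurePreserving_sumPiEquivProdPi_symm
    (fun _ : Fin k ⊕ Unit => E)).lintegral_comp hF
  rw [← h1]
  have hm : Measurable fun p : (Fin k → E) × (Unit → E) =>
      F ((MeasurableEquiv.sumPiEquivProdPi fun _ : Fin k ⊕ Unit => E).symm p) :=
    hF.comp (MeasurableEquiv.measurable _)
  rw [Measure.volume_eq_prod]
  refine (lintegral_prod _ hm.aemeasurable).trans (lintegral_congr fun z => ?_)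
  have h2 := (volume_preserving_funUnique Unit E).symm.lintegral_comp
    (hm.comp (measurable_prodMk_left (x := z)))
  refine h2.symm.trans (lintegral_congr fun w => ?_)
  refine congrArg F (funext fun i => ?_)
  rcases i with i | i <;> rfl

/-- The Gaussian measure of a set that restricts the last coordinate to a disc whose radius depends
on the other coordinates. -/
theorem gaussianMeasure_cone {𝕜 : Type*} [RCLike 𝕜] [MeasureSpace 𝕜] [BorelSpace 𝕜]
    [SigmaFinite (volume : Measure 𝕜)] {k : ℕ} {s : ℝ} (hs : s < 1) :
    gaussianMeasure (volume : Measure (Fin k ⊕ Unit → 𝕜))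
      {z | ‖z (Sum.inr ())‖ ^ 2 < s * ∑ i, ‖z i‖ ^ 2} =
    ∫⁻ z : Fin k → 𝕜, ENNReal.ofReal (Real.exp (-∑ i, ‖z i‖ ^ 2)) *
      ∫⁻ w in {w : 𝕜 | ‖w‖ ^ 2 < s / (1 - s) * ∑ i, ‖z i‖ ^ 2},
        ENNReal.ofReal (Real.exp (-‖w‖ ^ 2)) := by
  have hC : MeasurableSet {z : Fin k ⊕ Unit → 𝕜 | ‖z (Sum.inr ())‖ ^ 2 < s * ∑ i, ‖z i‖ ^ 2} :=
    measurableSet_lt (by fun_prop) (by fun_prop)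
  rw [gaussianMeasure, withDensity_apply _ hC, ← lintegral_indicator hC,
    lintegral_sum_unit (Measurable.indicator (by fun_prop) hC)]
  refine lintegral_congr fun z => ?_
  have hD : MeasurableSet {w : 𝕜 | ‖w‖ ^ 2 < s / (1 - s) * ∑ i, ‖z i‖ ^ 2} :=
    measurableSet_lt (by fun_prop) measurable_const
  rw [← lintegral_const_mul _ (by fun_prop), ← lintegral_indicator hD]
  refine lintegral_congr fun w => ?_
  have hiff : (Sum.elim z fun _ => w : Fin k ⊕ Unit → 𝕜) ∈
      {z : Fin k ⊕ Unit → 𝕜 | ‖z (Sum.inr ())‖ ^ 2 < s * ∑ i, ‖z i‖ ^ 2} ↔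
      w ∈ {w : 𝕜 | ‖w‖ ^ 2 < s / (1 - s) * ∑ i, ‖z i‖ ^ 2} := by
    have h1 : 0 < 1 - s := by linarith
    simp only [Set.mem_ofPred_eq, Fintype.sum_sum_type, Sum.elim_inl, Sum.elim_inr,
      Finset.univ_unique, Finset.sum_singleton]
    rw [div_mul_eq_mul_div, lt_div_iff₀ h1]
    constructor <;> intro h <;> linarith
  simp only [Set.indicator, hiff]
  split_ifs
  · simp only [Fintype.sum_sum_type, Sum.elim_inl, Sum.elim_inr, Finset.univ_unique,
      Finset.sum_singleton]
    rw [← ENNReal.ofReal_mul (Real.exp_pos _).le, ← Real.exp_add, neg_add]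
  · rfl

/-- `IsUniformStiefel.measure_mul_measure_univ` for the Gaussian measure. -/
theorem IsUniformStiefel.measure_mul_measure_univ_gaussian {𝕜 : Type*} [RCLike 𝕜]
    [MeasureSpace 𝕜] [BorelSpace 𝕜] [(volume : Measure 𝕜).IsAddHaarMeasure] {n k : ℕ}
    {ν : Measure (Matrix (Fin n) (Fin k) 𝕜)} (hν : IsUniformStiefel ν)
    {X : Matrix (Fin n) (Fin k ⊕ Unit) 𝕜} (hX : X ∈ stiefel 𝕜 (Fin n) (Fin k ⊕ Unit)) (s : ℝ) :
    ν {V | coeffSq X V (lastVec 𝕜 k) < s} *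
      gaussianMeasure (volume : Measure (Fin k ⊕ Unit → 𝕜)) Set.univ =
    gaussianMeasure (volume : Measure (Fin k ⊕ Unit → 𝕜))
      {z | ‖z (Sum.inr ())‖ ^ 2 < s * ∑ i, ‖z i‖ ^ 2} := by
  have : SFinite (gaussianMeasure (volume : Measure (Fin k ⊕ Unit → 𝕜))) := by
    unfold gaussianMeasure
    infer_instance
  have : NullSingletonClass (volume : Measure 𝕜) :=
    by
    have : (nhdsWithin (0 : 𝕜) {0}ᶜ).NeBot := NormedField.nhdsNE_neBot 0
    infer_instance
  refine hν.measure_mul_measure_univ hX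
    (fun W hW => map_unitary_mulVec_gaussianMeasure volume hW) ?_ s
  exact withDensity_absolutelyContinuous _ _ (measure_singleton 0)

theorem integrable_exp_neg_mul_sum {E : Type*} [NormedAddCommGroup E] [MeasureSpace E]
    [SigmaFinite (volume : Measure E)] {a : ℝ}
    (h : Integrable fun w : E => Real.exp (-a * ‖w‖ ^ 2)) (ι : Type*) [Fintype ι] :
    Integrable fun z : ι → E => Real.exp (-a * ∑ i, ‖z i‖ ^ 2) := by
  simp_rw [Finset.mul_sum, Real.exp_sum]
  exact Integrable.fintype_prod fun _ => h

theorem integral_exp_neg_mul_sum {E : Type*} [NormedAddCommGroup E] [MeasureSpace E]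
    [SigmaFinite (volume : Measure E)] (a : ℝ) (ι : Type*) [Fintype ι] :
    ∫ z : ι → E, Real.exp (-a * ∑ i, ‖z i‖ ^ 2) =
      (∫ w : E, Real.exp (-a * ‖w‖ ^ 2)) ^ Fintype.card ι := by
  simp_rw [Finset.mul_sum, Real.exp_sum]
  exact integral_fintype_prod_volume_eq_pow fun w : E => Real.exp (-a * ‖w‖ ^ 2)

theorem gaussianMeasure_univ {𝕜 : Type*} [RCLike 𝕜] [MeasureSpace 𝕜] [BorelSpace 𝕜]
    [SigmaFinite (volume : Measure 𝕜)] {ι : Type*} [Fintype ι]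
    (h : Integrable fun w : 𝕜 => Real.exp (-1 * ‖w‖ ^ 2)) :
    gaussianMeasure (volume : Measure (ι → 𝕜)) Set.univ =
      ENNReal.ofReal ((∫ w : 𝕜, Real.exp (-1 * ‖w‖ ^ 2)) ^ Fintype.card ι) := by
  rw [gaussianMeasure, withDensity_apply _ MeasurableSet.univ, Measure.restrict_univ,
    ← integral_exp_neg_mul_sum, ofReal_integral_eq_lintegral_ofReal
      (integrable_exp_neg_mul_sum h ι) (ae_of_all _ fun z => (Real.exp_pos _).le)]
  simp only [neg_one_mul]

/-! ### The complex Gaussian measure of a cone -/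

theorem integrable_exp_neg_mul_norm_sq_complex {a : ℝ} (ha : 0 < a) :
    Integrable fun w : ℂ => Real.exp (-a * ‖w‖ ^ 2) := by
  -- A non-integrable function would have the junk integral `0`.
  by_contra h
  have h1 := Complex.integral_exp_neg_mul_rpow (p := 2) one_le_two ha
  simp only [Real.rpow_ofNat] at h1
  rw [integral_undef h] at h1
  have : 0 < Real.pi * a ^ (-2 / 2 : ℝ) * Real.Gamma (2 / 2 + 1) := by
    have := Real.Gamma_pos_of_pos (s := 2 / 2 + 1) (by norm_num)
    positivity
  linarith

theorem integral_exp_neg_mul_norm_sq_complex {a : ℝ} (ha : 0 < a) :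
    ∫ w : ℂ, Real.exp (-a * ‖w‖ ^ 2) = Real.pi / a := by
  have h1 := Complex.integral_exp_neg_mul_rpow (p := 2) one_le_two ha
  simp only [Real.rpow_ofNat] at h1
  rw [h1, div_self two_ne_zero, one_add_one_eq_two, Real.Gamma_two, neg_div, div_self two_ne_zero,
    Real.rpow_neg_one]
  ring

theorem lintegral_disc_exp_neg_norm_sq {R : ℝ} (hR : 0 ≤ R) :
    ∫⁻ w in {w : ℂ | ‖w‖ ^ 2 < R}, ENNReal.ofReal (Real.exp (-‖w‖ ^ 2)) =
      ENNReal.ofReal (Real.pi * (1 - Real.exp (-R))) := by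
  have hD : MeasurableSet {w : ℂ | ‖w‖ ^ 2 < R} := measurableSet_lt (by fun_prop) measurable_const
  have hint : Integrable fun w : ℂ => Real.exp (-‖w‖ ^ 2) := by
    simpa using integrable_exp_neg_mul_norm_sq_complex one_pos
  rw [← ofReal_integral_eq_lintegral_ofReal hint.integrableOn
    (ae_of_all _ fun w => (Real.exp_pos _).le), ← integral_indicator hD]
  congr 1
  have h1 := integral_fun_norm_addHaar (volume : Measure ℂ)
    (fun y => ({y : ℝ | y ^ 2 < R}.indicator (fun y => Real.exp (-y ^ 2)) y : ℝ))
  have h2 : ∀ w : ℂ, {w : ℂ | ‖w‖ ^ 2 < R}.indicator (fun w => Real.exp (-‖w‖ ^ 2)) w =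
    {y : ℝ | y ^ 2 < R}.indicator (fun y => Real.exp (-y ^ 2)) ‖w‖ := fun w => rfl
  simp_rw [h2]
  rw [h1]
  have hvol : (volume : Measure ℂ).real (Metric.ball 0 1) = Real.pi := by
    simp [Measure.real, Complex.volume_ball]
  have hind : ∫ y in Set.Ioi (0 : ℝ), y ^ (Module.finrank ℝ ℂ - 1) •
      {y : ℝ | y ^ 2 < R}.indicator (fun y => Real.exp (-y ^ 2)) y =
      ∫ y in (0 : ℝ)..√R, y * Real.exp (-y ^ 2) := by
    rw [intervalIntegral.integral_of_le (Real.sqrt_nonneg R), integral_Ioc_eq_integral_Ioo,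
      ← integral_indicator measurableSet_Ioi, ← integral_indicator measurableSet_Ioo]
    congr 1
    ext y
    by_cases hy : 0 < y
    · have : y ^ 2 < R ↔ y < √R := (Real.lt_sqrt hy.le).symm
      by_cases h : y < √R <;> simp [Set.indicator, hy, this, h]
    · simp [Set.indicator, hy]
  have hFTC : ∫ y in (0 : ℝ)..√R, y * Real.exp (-y ^ 2) = (1 - Real.exp (-R)) / 2 := by
    have hd : ∀ y ∈ Set.uIcc 0 √R, HasDerivAt (fun y : ℝ => -Real.exp (-y ^ 2) / 2)
        (y * Real.exp (-y ^ 2)) y := by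
      intro y _
      have := (((hasDerivAt_pow 2 y).neg.exp).neg).div_const 2
      convert! this using 1
      simp
      ring
    rw [intervalIntegral.integral_eq_sub_of_hasDerivAt hd
      (Continuous.intervalIntegrable (by fun_prop) _ _), Real.sq_sqrt hR]
    simp
    ring
  rw [hind, hFTC, hvol, Complex.finrank_real_complex]
  simp
  ring

theorem gaussianMeasure_cone_complex {k : ℕ} {s : ℝ} (hs0 : 0 ≤ s) (hs1 : s < 1) :
    gaussianMeasure (volume : Measure (Fin k ⊕ Unit → ℂ))
      {z | ‖z (Sum.inr ())‖ ^ 2 < s * ∑ i, ‖z i‖ ^ 2} =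
    ENNReal.ofReal ((1 - (1 - s) ^ k) * Real.pi ^ (k + 1)) := by
  have h1s : 0 < 1 - s := by linarith
  rw [gaussianMeasure_cone hs1]
  set q : ℝ := s / (1 - s) with hq
  have hq0 : 0 ≤ q := by positivity
  have hq1 : 1 + q = (1 - s)⁻¹ := by rw [hq]; field_simp; ring
  have hcone : ∀ z : Fin k → ℂ, ENNReal.ofReal (Real.exp (-∑ i, ‖z i‖ ^ 2)) *
      ∫⁻ w in {w : ℂ | ‖w‖ ^ 2 < q * ∑ i, ‖z i‖ ^ 2}, ENNReal.ofReal (Real.exp (-‖w‖ ^ 2)) =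
      ENNReal.ofReal (Real.pi * (Real.exp (-1 * ∑ i, ‖z i‖ ^ 2) -
        Real.exp (-(1 + q) * ∑ i, ‖z i‖ ^ 2))) := by
    intro z
    rw [lintegral_disc_exp_neg_norm_sq (by positivity), ← ENNReal.ofReal_mul (Real.exp_pos _).le]
    congr 1
    rw [show -(1 + q) * ∑ i, ‖z i‖ ^ 2 = -∑ i, ‖z i‖ ^ 2 + -(q * ∑ i, ‖z i‖ ^ 2) by ring,
      Real.exp_add, neg_one_mul]
    ring
  have hi1 : Integrable fun z : Fin k → ℂ => Real.exp (-1 * ∑ i, ‖z i‖ ^ 2) :=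
    integrable_exp_neg_mul_sum (integrable_exp_neg_mul_norm_sq_complex one_pos) _
  have hi2 : Integrable fun z : Fin k → ℂ => Real.exp (-(1 + q) * ∑ i, ‖z i‖ ^ 2) :=
    integrable_exp_neg_mul_sum (integrable_exp_neg_mul_norm_sq_complex (by positivity)) _
  have hnn : ∀ z : Fin k → ℂ, 0 ≤ Real.pi * (Real.exp (-1 * ∑ i, ‖z i‖ ^ 2) -
        Real.exp (-(1 + q) * ∑ i, ‖z i‖ ^ 2)) := by
    intro z
    refine mul_nonneg Real.pi_pos.le (sub_nonneg.2 (Real.exp_le_exp.2 ?_))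
    have : 0 ≤ q * ∑ i, ‖z i‖ ^ 2 := by positivity
    linarith
  have hi : Integrable fun z : Fin k → ℂ => Real.pi * (Real.exp (-1 * ∑ i, ‖z i‖ ^ 2) -
      Real.exp (-(1 + q) * ∑ i, ‖z i‖ ^ 2)) := (hi1.sub hi2).const_mul _
  rw [lintegral_congr hcone, ← ofReal_integral_eq_lintegral_ofReal hi (ae_of_all _ hnn), integral_const_mul, integral_sub hi1 hi2, integral_exp_neg_mul_sum,
    integral_exp_neg_mul_sum, integral_exp_neg_mul_norm_sq_complex one_pos,
    integral_exp_neg_mul_norm_sq_complex (by positivity), hq1, Fintype.card_fin, div_one,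
    div_inv_eq_mul, mul_pow]
  congr 1
  ring

/-- For a uniformly distributed unit vector of `ℂ^(k + 1)`, the squared modulus of a coordinate is
less than `s` with probability `1 - (1 - s)^k`. -/
theorem IsUniformStiefel.measure_coeffSq_lt_complex {n k : ℕ}
    {ν : Measure (Matrix (Fin n) (Fin k) ℂ)} (hν : IsUniformStiefel ν)
    {X : Matrix (Fin n) (Fin k ⊕ Unit) ℂ} (hX : X ∈ stiefel ℂ (Fin n) (Fin k ⊕ Unit)) {s : ℝ}
    (hs0 : 0 ≤ s) (hs1 : s < 1) :
    ν {V | coeffSq X V (lastVec ℂ k) < s} = ENNReal.ofReal (1 - (1 - s) ^ k) := by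
  have h := hν.measure_mul_measure_univ_gaussian hX s
  rw [gaussianMeasure_univ (integrable_exp_neg_mul_norm_sq_complex one_pos),
    integral_exp_neg_mul_norm_sq_complex one_pos, gaussianMeasure_cone_complex hs0 hs1,
    Fintype.card_sum, Fintype.card_fin, Fintype.card_unit, div_one] at h
  have hpi : (0 : ℝ) < Real.pi ^ (k + 1) := by positivity
  rw [ENNReal.ofReal_mul' hpi.le] at h
  exact (ENNReal.mul_left_inj (ENNReal.ofReal_pos.2 hpi).ne' ENNReal.ofReal_ne_top).1 h

theorem IsUniformStiefel.measure_coeffSq_lt_le_complex {n k : ℕ} (hk : 1 ≤ k)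
    {ν : Measure (Matrix (Fin n) (Fin k) ℂ)} (hν : IsUniformStiefel ν)
    {X : Matrix (Fin n) (Fin k ⊕ Unit) ℂ} (hX : X ∈ stiefel ℂ (Fin n) (Fin k ⊕ Unit)) {s : ℝ}
    (hs0 : 0 ≤ s) : ν {V | coeffSq X V (lastVec ℂ k) < s} ≤ ENNReal.ofReal (k * s) := by
  have hk' : (1 : ℝ) ≤ k := by exact_mod_cast hk
  rcases lt_or_ge s 1 with hs1 | hs1
  · rw [hν.measure_coeffSq_lt_complex hX hs0 hs1]
    refine ENNReal.ofReal_le_ofReal ?_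
    have := one_add_mul_le_pow (a := -s) (by linarith) k
    rw [← sub_eq_add_neg] at this
    linarith
  · have := hν.isProbabilityMeasure
    exact prob_le_one.trans (ENNReal.one_le_ofReal.2 (by nlinarith))

/-! ### The real Gaussian measure of a cone -/

theorem integrable_exp_neg_norm_sq_real :
    Integrable fun w : ℝ => Real.exp (-1 * ‖w‖ ^ 2) := by
  simpa using integrable_exp_neg_mul_sq one_pos

theorem integral_exp_neg_norm_sq_real : ∫ w : ℝ, Real.exp (-1 * ‖w‖ ^ 2) = √Real.pi := by
  simpa using integral_gaussian 1

theorem integrable_sq_mul_exp_neg_sq : Integrable fun w : ℝ => w ^ 2 * Real.exp (-1 * w ^ 2) := by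
  simpa using integrable_rpow_mul_exp_neg_mul_sq (b := 1) one_pos (s := 2) (by norm_num)

theorem integral_sq_mul_exp_neg_sq :
    ∫ w : ℝ, w ^ 2 * Real.exp (-1 * w ^ 2) = 1 / 2 * √Real.pi := by
  -- Integration by parts: the derivative of `w exp (-w²)` has integral `0`.
  have hd : ∀ w : ℝ, HasDerivAt (fun w : ℝ => w * Real.exp (-1 * w ^ 2))
      (Real.exp (-1 * w ^ 2) - 2 * (w ^ 2 * Real.exp (-1 * w ^ 2))) w := by
    intro w
    have := (hasDerivAt_id w).mul (((hasDerivAt_pow 2 w).const_mul (-1)).exp)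
    convert! this using 1
    simp
    ring
  have h1 := integrable_exp_neg_mul_sq (b := 1) one_pos
  have h2 := integrable_sq_mul_exp_neg_sq.const_mul 2
  have h := integral_eq_zero_of_hasDerivAt_of_integrable hd (h1.sub h2)
    (integrable_mul_exp_neg_mul_sq one_pos)
  rw [integral_sub h1 h2, integral_const_mul, integral_gaussian, div_one] at h
  linarith

theorem integrable_and_integral_coord_sq_mul_exp {k : ℕ} (i : Fin k) :
    (Integrable fun z : Fin k → ℝ => ‖z i‖ ^ 2 * Real.exp (-1 * ∑ j, ‖z j‖ ^ 2)) ∧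
    ∫ z : Fin k → ℝ, ‖z i‖ ^ 2 * Real.exp (-1 * ∑ j, ‖z j‖ ^ 2) = 1 / 2 * √Real.pi ^ k := by
  let g : Fin k → ℝ → ℝ := fun j w => (if j = i then w ^ 2 else 1) * Real.exp (-1 * w ^ 2)
  have hg : ∀ z : Fin k → ℝ, ‖z i‖ ^ 2 * Real.exp (-1 * ∑ j, ‖z j‖ ^ 2) = ∏ j, g j (z j) := by
    intro z
    simp only [g, Finset.prod_mul_distrib, Finset.mul_sum, Real.exp_sum, Real.norm_eq_abs, sq_abs]
    simp
  have hgi : ∀ j, Integrable (g j) := by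
    intro j
    by_cases h : j = i
    · simpa [g, h] using integrable_sq_mul_exp_neg_sq
    · simpa [g, h] using integrable_exp_neg_mul_sq (b := 1) one_pos
  have hgv : ∀ j, ∫ w, g j w = (if j = i then 1 / 2 else 1) * √Real.pi := by
    intro j
    by_cases h : j = i
    · simpa [g, h] using integral_sq_mul_exp_neg_sq
    · simpa [g, h] using integral_gaussian 1
  simp_rw [hg]
  refine ⟨Integrable.fintype_prod hgi, ?_⟩
  rw [integral_fintype_prod_volume_eq_prod]
  simp_rw [hgv, Finset.prod_mul_distrib]
  simp

theorem integrable_sum_sq_mul_exp (k : ℕ) : Integrable fun z : Fin k → ℝ =>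
    (∑ j, ‖z j‖ ^ 2) * Real.exp (-1 * ∑ j, ‖z j‖ ^ 2) := by
  simp_rw [Finset.sum_mul]
  exact integrable_finsetSum _ fun i _ => (integrable_and_integral_coord_sq_mul_exp i).1

theorem integrable_sqrt_sum_sq_mul_exp (k : ℕ) : Integrable fun z : Fin k → ℝ =>
    √(∑ j, ‖z j‖ ^ 2) * Real.exp (-1 * ∑ j, ‖z j‖ ^ 2) := by
  have hi0 : Integrable fun z : Fin k → ℝ => Real.exp (-1 * ∑ j, ‖z j‖ ^ 2) :=
    integrable_exp_neg_mul_sum integrable_exp_neg_norm_sq_real _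
  refine (hi0.add (integrable_sum_sq_mul_exp k)).mono' (Continuous.aestronglyMeasurable (by fun_prop))
    (ae_of_all _ fun z => ?_)
  have hN : 0 ≤ ∑ j, ‖z j‖ ^ 2 := by positivity
  have h1 : √(∑ j, ‖z j‖ ^ 2) ≤ 1 + ∑ j, ‖z j‖ ^ 2 :=
    Real.sqrt_le_iff.2 ⟨by positivity, by nlinarith⟩
  rw [Real.norm_eq_abs, abs_of_nonneg (by positivity)]
  calc _ ≤ (1 + ∑ j, ‖z j‖ ^ 2) * Real.exp (-1 * ∑ j, ‖z j‖ ^ 2) := by gcongr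
    _ = _ := by simp only [Pi.add_apply]; ring

/-- For the norm of a Gaussian vector the Cauchy–Schwarz inequality `E ‖z‖ ≤ (E ‖z‖²)^(1/2)` is
strict, since `‖z‖` is not constant. -/
theorem integral_sqrt_sum_sq_mul_exp_lt {k : ℕ} (hk : 1 ≤ k) :
    ∫ z : Fin k → ℝ, √(∑ j, ‖z j‖ ^ 2) * Real.exp (-1 * ∑ j, ‖z j‖ ^ 2) <
      √(k / 2) * √Real.pi ^ k := by
  have hi0 : Integrable fun z : Fin k → ℝ => Real.exp (-1 * ∑ j, ‖z j‖ ^ 2) :=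
    integrable_exp_neg_mul_sum integrable_exp_neg_norm_sq_real _
  have hv0 : ∫ z : Fin k → ℝ, Real.exp (-1 * ∑ j, ‖z j‖ ^ 2) = √Real.pi ^ k := by
    rw [integral_exp_neg_mul_sum, integral_exp_neg_norm_sq_real, Fintype.card_fin]
  have hi2 := integrable_sum_sq_mul_exp k
  have hv2 : ∫ z : Fin k → ℝ, (∑ j, ‖z j‖ ^ 2) * Real.exp (-1 * ∑ j, ‖z j‖ ^ 2) =
      k / 2 * √Real.pi ^ k := by
    simp_rw [Finset.sum_mul]
    rw [integral_finsetSum _ fun i _ => (integrable_and_integral_coord_sq_mul_exp i).1]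
    simp_rw [(integrable_and_integral_coord_sq_mul_exp _).2]
    simp
    ring
  have hi1 := integrable_sqrt_sum_sq_mul_exp k
  set c : ℝ := √(k / 2) with hc
  have hk0 : (0 : ℝ) < k := by exact_mod_cast hk
  have hcpos : 0 < c := Real.sqrt_pos.2 (by positivity)
  have hc2 : c ^ 2 = k / 2 := Real.sq_sqrt (by positivity)
  let f : (Fin k → ℝ) → ℝ := fun z =>
    (√(∑ j, ‖z j‖ ^ 2) - c) ^ 2 * Real.exp (-1 * ∑ j, ‖z j‖ ^ 2)
  have hfeq : ∀ z, f z = (∑ j, ‖z j‖ ^ 2) * Real.exp (-1 * ∑ j, ‖z j‖ ^ 2) -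
      2 * c * (√(∑ j, ‖z j‖ ^ 2) * Real.exp (-1 * ∑ j, ‖z j‖ ^ 2)) +
      c ^ 2 * Real.exp (-1 * ∑ j, ‖z j‖ ^ 2) := by
    intro z
    have hN : √(∑ j, ‖z j‖ ^ 2) ^ 2 = ∑ j, ‖z j‖ ^ 2 := Real.sq_sqrt (by positivity)
    simp only [f, sub_sq, hN]
    ring
  have hi21 : Integrable fun z : Fin k → ℝ =>
      (∑ j, ‖z j‖ ^ 2) * Real.exp (-1 * ∑ j, ‖z j‖ ^ 2) -
        2 * c * (√(∑ j, ‖z j‖ ^ 2) * Real.exp (-1 * ∑ j, ‖z j‖ ^ 2)) :=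
    hi2.sub (hi1.const_mul (2 * c))
  have hfi : Integrable f := by
    simp_rw [funext hfeq]
    exact hi21.add (hi0.const_mul (c ^ 2))
  have hfv : ∫ z, f z = k * √Real.pi ^ k -
      2 * c * ∫ z : Fin k → ℝ, √(∑ j, ‖z j‖ ^ 2) * Real.exp (-1 * ∑ j, ‖z j‖ ^ 2) := by
    simp_rw [hfeq]
    rw [integral_add hi21 (hi0.const_mul (c ^ 2)),
      integral_sub hi2 (hi1.const_mul (2 * c)), integral_const_mul, integral_const_mul, hv0, hv2,
      hc2]
    ring
  have hfpos : 0 < ∫ z, f z := by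
    rw [integral_pos_iff_support_of_nonneg (fun z => by positivity) hfi]
    have hfc : Continuous f := by fun_prop
    refine (isOpen_ne.preimage hfc).measure_pos volume ⟨0, ?_⟩
    simp [f, hcpos.ne']
  rw [hfv] at hfpos
  have h3 : 2 * c * ∫ z : Fin k → ℝ, √(∑ j, ‖z j‖ ^ 2) * Real.exp (-1 * ∑ j, ‖z j‖ ^ 2) <
      2 * c * (c * √Real.pi ^ k) := by
    have : 2 * c * (c * √Real.pi ^ k) = k * √Real.pi ^ k := by
      rw [show 2 * c * (c * √Real.pi ^ k) = 2 * c ^ 2 * √Real.pi ^ k by ring, hc2]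
      ring
    linarith
  exact lt_of_mul_lt_mul_left h3 (by positivity)

theorem lintegral_disc_exp_neg_sq_le {R : ℝ} :
    ∫⁻ w in {w : ℝ | ‖w‖ ^ 2 < R}, ENNReal.ofReal (Real.exp (-‖w‖ ^ 2)) ≤
      ENNReal.ofReal (2 * √R) := by
  calc ∫⁻ w in {w : ℝ | ‖w‖ ^ 2 < R}, ENNReal.ofReal (Real.exp (-‖w‖ ^ 2))
      ≤ ∫⁻ w in {w : ℝ | ‖w‖ ^ 2 < R}, 1 := by
        refine lintegral_mono fun w => ?_
        rw [ENNReal.ofReal_le_one, Real.exp_le_one_iff]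
        linarith [sq_nonneg ‖w‖]
    _ = volume {w : ℝ | ‖w‖ ^ 2 < R} := setLIntegral_one _
    _ ≤ volume (Set.Ioo (-√R) √R) := by
        refine measure_mono fun w hw => ?_
        rw [Set.mem_Ioo, ← abs_lt]
        exact Real.lt_sqrt_of_sq_lt hw
    _ = ENNReal.ofReal (2 * √R) := by rw [Real.volume_Ioo]; congr 1; ring

theorem gaussianMeasure_cone_real_le {k : ℕ} {s : ℝ} (hs0 : 0 ≤ s) (hs1 : s < 1) :
    gaussianMeasure (volume : Measure (Fin k ⊕ Unit → ℝ))
      {z | ‖z (Sum.inr ())‖ ^ 2 < s * ∑ i, ‖z i‖ ^ 2} ≤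
    ENNReal.ofReal (2 * √(s / (1 - s)) *
      ∫ z : Fin k → ℝ, √(∑ j, ‖z j‖ ^ 2) * Real.exp (-1 * ∑ j, ‖z j‖ ^ 2)) := by
  have h1s : 0 < 1 - s := by linarith
  rw [gaussianMeasure_cone hs1]
  set q : ℝ := s / (1 - s) with hq
  have hq0 : 0 ≤ q := by positivity
  rw [← integral_const_mul]
  refine le_trans (lintegral_mono (g := fun z => ENNReal.ofReal (2 * √q *
    (√(∑ j, ‖z j‖ ^ 2) * Real.exp (-1 * ∑ j, ‖z j‖ ^ 2)))) fun z => ?_) ?_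
  · refine (mul_le_mul_right lintegral_disc_exp_neg_sq_le _).trans_eq ?_
    rw [← ENNReal.ofReal_mul (Real.exp_pos _).le, Real.sqrt_mul hq0]
    simp only [neg_one_mul]
    congr 1
    ring
  · rw [← ofReal_integral_eq_lintegral_ofReal ?_ (ae_of_all _ fun z => by positivity)]
    exact (integrable_sqrt_sum_sq_mul_exp k).const_mul _

/-- Near `0`, the distribution function of the modulus of a coordinate of a uniformly distributed
unit vector of `ℝ^(k + 1)` is at most `√(2 k / π) σ`. -/
theorem exists_measure_coeffSq_lt_le_real {k : ℕ} (hk : 1 ≤ k) :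
    ∃ σ₀ : ℝ, 0 < σ₀ ∧ ∀ (n : ℕ) (ν : Measure (Matrix (Fin n) (Fin k) ℝ)), IsUniformStiefel ν →
      ∀ X ∈ stiefel ℝ (Fin n) (Fin k ⊕ Unit), ∀ σ : ℝ, 0 < σ → σ ≤ σ₀ →
      ν {V | coeffSq X V (lastVec ℝ k) < σ ^ 2} ≤ ENNReal.ofReal (√(2 * k / Real.pi) * σ) := by
  set J : ℝ := ∫ z : Fin k → ℝ, √(∑ j, ‖z j‖ ^ 2) * Real.exp (-1 * ∑ j, ‖z j‖ ^ 2) with hJ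
  have hJ0 : 0 ≤ J := integral_nonneg fun z => by positivity
  have hJlt : J < √(k / 2) * √Real.pi ^ k := integral_sqrt_sum_sq_mul_exp_lt hk
  set c : ℝ := √(2 * k / Real.pi) with hc
  have hk0 : (0 : ℝ) < k := by exact_mod_cast hk
  have hpi := Real.sqrt_pos.2 Real.pi_pos
  have hc0 : 0 < c := Real.sqrt_pos.2 (by positivity)
  have hcJ : 2 * J < c * √Real.pi ^ (k + 1) := by
    have h1 : c * √Real.pi ^ (k + 1) = 2 * (√(k / 2) * √Real.pi ^ k) := by
      have h2 : c * √Real.pi = 2 * √(k / 2) := by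
        rw [hc, ← Real.sqrt_mul (by positivity), div_mul_cancel₀ _ Real.pi_pos.ne',
          show (2 * k : ℝ) = 2 ^ 2 * (k / 2) by ring, Real.sqrt_mul (by positivity),
          Real.sqrt_sq two_pos.le]
      rw [pow_succ']
      linear_combination √Real.pi ^ k * h2
    rw [h1]
    linarith
  set D : ℝ := c * √Real.pi ^ (k + 1) with hD
  have hD0 : 0 < D := by positivity
  set r : ℝ := 2 * J / D with hr
  have hr0 : 0 ≤ r := by positivity
  have hr1 : r < 1 := (div_lt_one hD0).2 hcJ
  have hr2 : r ^ 2 < 1 := by nlinarith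
  -- The strict inequality `r < 1` leaves room for the factor `(1 - σ²)^(-1/2)`.
  refine ⟨√((1 - r ^ 2) / 2), Real.sqrt_pos.2 (by linarith), fun n ν hν X hX σ hσ0 hσ => ?_⟩
  have hσ2 : σ ^ 2 ≤ (1 - r ^ 2) / 2 := by
    rw [← Real.sq_sqrt (show 0 ≤ (1 - r ^ 2) / 2 by linarith)]
    exact pow_le_pow_left₀ hσ0.le hσ 2
  have hs1 : σ ^ 2 < 1 := by nlinarith
  have h1s : 0 < 1 - σ ^ 2 := by linarith
  have hsq : r ≤ √(1 - σ ^ 2) := Real.le_sqrt_of_sq_le (by nlinarith)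
  have h := hν.measure_mul_measure_univ_gaussian hX (σ ^ 2)
  rw [gaussianMeasure_univ integrable_exp_neg_norm_sq_real, integral_exp_neg_norm_sq_real,
    Fintype.card_sum, Fintype.card_fin, Fintype.card_unit] at h
  have h2 := h.trans_le (gaussianMeasure_cone_real_le (sq_nonneg σ) hs1)
  have hP : 0 < √Real.pi ^ (k + 1) := by positivity
  have h3 : 2 * √(σ ^ 2 / (1 - σ ^ 2)) * J ≤ c * σ * √Real.pi ^ (k + 1) := by
    rw [Real.sqrt_div (sq_nonneg σ), Real.sqrt_sq hσ0.le]
    have hs : 0 < √(1 - σ ^ 2) := Real.sqrt_pos.2 h1s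
    have h4 : 2 * J ≤ √(1 - σ ^ 2) * D := by
      rw [← div_le_iff₀ hD0]
      exact hsq
    rw [show 2 * (σ / √(1 - σ ^ 2)) * J = σ * (2 * J) / √(1 - σ ^ 2) by ring, div_le_iff₀ hs]
    calc σ * (2 * J) ≤ σ * (√(1 - σ ^ 2) * D) := by gcongr
      _ = _ := by rw [hD]; ring
  have h5 := h2.trans (ENNReal.ofReal_le_ofReal h3)
  rw [ENNReal.ofReal_mul' hP.le] at h5
  exact (ENNReal.mul_le_mul_iff_left (ENNReal.ofReal_pos.2 hP).ne' ENNReal.ofReal_ne_top).1 h5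

/-! ### Small values of a product of independent variables -/

/-- A bound for the integral `∫⁻ P (b < t / u) du` over `0 < u < s₀`. -/
theorem lintegral_measure_mul_lt_le {P : Measure ℝ} [IsProbabilityMeasure P] {c s₀ t : ℝ}
    (hc : 0 ≤ c) (hs₀ : 0 < s₀) (hP : ∀ s, 0 < s → s ≤ s₀ → P (Set.Iio s) ≤ ENNReal.ofReal (c * s))
    (ht : 0 < t) (hts : t ≤ s₀ ^ 2) :
    ∫⁻ u in Set.Ioo 0 s₀, P {b | u * b < t} ≤
      ENNReal.ofReal (t / s₀ + c * t * Real.log (s₀ ^ 2 / t)) := by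
  have hε : 0 < t / s₀ := by positivity
  have hε' : t / s₀ ≤ s₀ := by rw [div_le_iff₀ hs₀]; nlinarith
  have hsub : Set.Ioo 0 s₀ ⊆ Set.Ioc 0 (t / s₀) ∪ Set.Ioc (t / s₀) s₀ := by
    rw [Set.Ioc_union_Ioc_eq_Ioc hε.le hε']
    exact Set.Ioo_subset_Ioc_self
  have h1 : ∫⁻ u in Set.Ioc 0 (t / s₀), P {b | u * b < t} ≤ ENNReal.ofReal (t / s₀) := by
    refine (lintegral_mono fun u => prob_le_one).trans ?_
    simp
  have h2 : ∫⁻ u in Set.Ioc (t / s₀) s₀, P {b | u * b < t} ≤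
      ENNReal.ofReal (c * t * Real.log (s₀ ^ 2 / t)) := by
    have h3 : ∀ u ∈ Set.Ioc (t / s₀) s₀, P {b | u * b < t} ≤ ENNReal.ofReal (c * t * u⁻¹) := by
      intro u hu
      have hu0 : 0 < u := hε.trans hu.1
      have h4 : {b | u * b < t} = Set.Iio (t / u) := by
        ext b
        simp [lt_div_iff₀ hu0, mul_comm]
      rw [h4]
      refine (hP _ (by positivity) ?_).trans_eq (by rw [mul_assoc, div_eq_mul_inv])
      rw [div_le_iff₀ hu0, mul_comm, ← div_le_iff₀ hs₀]
      exact hu.1.le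
    have hint : IntervalIntegrable (fun u : ℝ => c * t * u⁻¹) volume (t / s₀) s₀ := by
      refine (intervalIntegral.intervalIntegrable_inv (fun u hu => ?_) continuousOn_id).const_mul _
      rw [Set.uIcc_of_le hε'] at hu
      exact (hε.trans_le hu.1).ne'
    refine (setLIntegral_mono' measurableSet_Ioc h3).trans_eq ?_
    rw [← ofReal_integral_eq_lintegral_ofReal]
    · rw [← intervalIntegral.integral_of_le hε', intervalIntegral.integral_const_mul,
        integral_inv_of_pos hε hs₀]
      congr 3
      field_simp
    · exact (intervalIntegrable_iff_integrableOn_Ioc_of_le hε').1 hint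
    · refine (ae_restrict_iff' measurableSet_Ioc).2 (ae_of_all _ fun u hu => ?_)
      have hu0 : 0 < u := hε.trans hu.1
      exact (by positivity : (0 : ℝ) ≤ c * t * u⁻¹)
  have hlog : 0 ≤ Real.log (s₀ ^ 2 / t) := Real.log_nonneg ((one_le_div ht).2 hts)
  calc _ ≤ _ := lintegral_mono_set hsub
    _ ≤ _ := lintegral_union_le _ _ _
    _ ≤ _ := add_le_add h1 h2
    _ = _ := (ENNReal.ofReal_add hε.le (by positivity)).symm

/-- If the distribution functions of independent `a, b ≥ 0` are at most `c s` for `s ≤ s₀`, then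
`P (a b < t)` is of order `c² t log (1 / t)`. For `s₀ = 1 / c` the extremal case is that of `a`, `b`
uniformly distributed on `[0, 1 / c]`, for which the bound is an equality. -/
theorem measure_prod_mul_lt_le {P Q : Measure ℝ} [IsProbabilityMeasure P] [IsProbabilityMeasure Q]
    {c s₀ t : ℝ} (hc : 0 ≤ c) (hs₀ : 0 < s₀)
    (hP : ∀ s, 0 < s → s ≤ s₀ → P (Set.Iio s) ≤ ENNReal.ofReal (c * s))
    (hQ : ∀ s, 0 < s → s ≤ s₀ → Q (Set.Iio s) ≤ ENNReal.ofReal (c * s))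
    (hQ0 : ∀ᵐ b ∂Q, 0 ≤ b) (ht : 0 < t) (hts : t ≤ s₀ ^ 2) :
    (P.prod Q) {p | p.1 * p.2 < t} ≤
      ENNReal.ofReal (c * (t / s₀ + c * t * Real.log (s₀ ^ 2 / t)) +
        max 0 (1 - c * s₀) * (c * (t / s₀))) := by
  have hε : 0 < t / s₀ := by positivity
  have hε' : t / s₀ ≤ s₀ := by rw [div_le_iff₀ hs₀]; nlinarith
  have hS : MeasurableSet {p : ℝ × ℝ | p.1 * p.2 < t} :=
    measurableSet_lt (by fun_prop) measurable_const
  set d : ℝ := max 0 (1 - c * s₀) with hd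
  have hd0 : 0 ≤ d := le_max_left _ _
  -- `min s₀ (t / b)` is written as the length of `{u ∈ (0, s₀) | u b < t}`.
  have hsec : ∀ b : ℝ, 0 ≤ b → P {a | a * b < t} ≤
      ENNReal.ofReal c * (volume.restrict (Set.Ioo 0 s₀)) {u | u * b < t} +
        ENNReal.ofReal d * (Set.Iio (t / s₀)).indicator 1 b := by
    intro b hb
    have hm : MeasurableSet {u : ℝ | u * b < t} := measurableSet_lt (by fun_prop) measurable_const
    rw [Measure.restrict_apply hm]
    by_cases hbt : b < t / s₀
    · have h1 : {u : ℝ | u * b < t} ∩ Set.Ioo 0 s₀ = Set.Ioo 0 s₀ := by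
        refine Set.inter_eq_right.2 fun u hu => ?_
        have h2 : b * s₀ < t := (lt_div_iff₀ hs₀).1 hbt
        have h3 : u * b ≤ s₀ * b := mul_le_mul_of_nonneg_right hu.2.le hb
        simp only [Set.mem_ofPred_eq]
        linarith
      rw [h1, Real.volume_Ioo, Set.indicator_of_mem (Set.mem_Iio.2 hbt), Pi.one_apply, mul_one,
        sub_zero, ← ENNReal.ofReal_mul hc, ← ENNReal.ofReal_add (by positivity) hd0]
      refine prob_le_one.trans (ENNReal.one_le_ofReal.2 ?_)
      have := le_max_right 0 (1 - c * s₀)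
      linarith
    · rw [not_lt] at hbt
      have hb0 : 0 < b := hε.trans_le hbt
      have htb : t / b ≤ s₀ := by
        rw [div_le_iff₀ hb0, mul_comm]
        exact (div_le_iff₀ hs₀).1 hbt
      have h1 : {u : ℝ | u * b < t} = Set.Iio (t / b) := by
        ext u
        simp [lt_div_iff₀ hb0]
      have h2 : Set.Iio (t / b) ∩ Set.Ioo 0 s₀ = Set.Ioo 0 (t / b) := by
        ext u
        simp only [Set.mem_inter_iff, Set.mem_Iio, Set.mem_Ioo]
        constructor
        · rintro ⟨h, h', -⟩; exact ⟨h', h⟩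
        · rintro ⟨h, h'⟩; exact ⟨h', h, h'.trans_le htb⟩
      rw [h1, h2, Real.volume_Ioo, sub_zero, ← ENNReal.ofReal_mul hc]
      exact (hP _ (by positivity) htb).trans le_self_add
  have hSm : Measurable fun b => (volume.restrict (Set.Ioo 0 s₀)) {u : ℝ | u * b < t} :=
    measurable_measure_prodMk_right hS
  have hswap : ∫⁻ b, (volume.restrict (Set.Ioo 0 s₀)) {u : ℝ | u * b < t} ∂Q =
      ∫⁻ u in Set.Ioo 0 s₀, Q {b | u * b < t} :=
    (Measure.prod_apply_symm hS).symm.trans (Measure.prod_apply hS)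
  have hlog : 0 ≤ Real.log (s₀ ^ 2 / t) := Real.log_nonneg ((one_le_div ht).2 hts)
  calc (P.prod Q) {p | p.1 * p.2 < t} = ∫⁻ b, P {a | a * b < t} ∂Q := Measure.prod_apply_symm hS
    _ ≤ ∫⁻ b, (ENNReal.ofReal c * (volume.restrict (Set.Ioo 0 s₀)) {u | u * b < t} +
        ENNReal.ofReal d * (Set.Iio (t / s₀)).indicator 1 b) ∂Q := by
      refine lintegral_mono_ae ?_
      filter_upwards [hQ0] with b hb using hsec b hb
    _ = ENNReal.ofReal c * (∫⁻ u in Set.Ioo 0 s₀, Q {b | u * b < t}) +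
        ENNReal.ofReal d * Q (Set.Iio (t / s₀)) := by
      rw [lintegral_add_left (hSm.const_mul _), lintegral_const_mul _ hSm, hswap,
        lintegral_const_mul _ (measurable_one.indicator measurableSet_Iio),
        lintegral_indicator_one measurableSet_Iio]
    _ ≤ ENNReal.ofReal c * ENNReal.ofReal (t / s₀ + c * t * Real.log (s₀ ^ 2 / t)) +
        ENNReal.ofReal d * ENNReal.ofReal (c * (t / s₀)) := by
      gcongr
      · exact lintegral_measure_mul_lt_le hc hs₀ hQ ht hts
      · exact hQ _ hε hε'
    _ = _ := by
      rw [← ENNReal.ofReal_mul hc, ← ENNReal.ofReal_mul hd0,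
        ← ENNReal.ofReal_add (by positivity) (by positivity)]

theorem measure_mul_lt_eq_prod {Ω : Type*} [MeasurableSpace Ω] {μ : Measure Ω}
    [IsProbabilityMeasure μ] {a b : Ω → ℝ} (ha : Measurable a) (hb : Measurable b)
    (h : IndepFun a b μ) (t : ℝ) :
    μ {ω | a ω * b ω < t} = ((μ.map a).prod (μ.map b)) {p | p.1 * p.2 < t} := by
  rw [← (indepFun_iff_map_prod_eq_prod_map_map ha.aemeasurable hb.aemeasurable).1 h,
    Measure.map_apply (ha.prodMk hb) (measurableSet_lt (by fun_prop) measurable_const)]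
  rfl

/-! ### Eigenvectors of the modified pencil -/

section Deterministic

variable {𝕜 : Type*} [RCLike 𝕜] {n k : ℕ}

/-- If `ran M` and `ran U` have trivial intersection, the kernel of `M + U D Vᴴ` is contained in
those of `M` and `Vᴴ`. The columns of `Y₁` are orthogonal to `ran M`. -/
theorem mulVec_eq_zero_of_add_mul_mulVec_eq_zero {M : Matrix (Fin n) (Fin n) 𝕜}
    {U V Y₁ : Matrix (Fin n) (Fin k) 𝕜} {D : Matrix (Fin k) (Fin k) 𝕜} (hY : Mᴴ * Y₁ = 0)
    (hU : (Uᴴ * Y₁).det ≠ 0) (hD : D.det ≠ 0) {ξ : Fin n → 𝕜}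
    (h : (M + U * D * Vᴴ) *ᵥ ξ = 0) : Vᴴ *ᵥ ξ = 0 ∧ M *ᵥ ξ = 0 := by
  have hY' : Y₁ᴴ * M = 0 := by
    have := congrArg Matrix.conjTranspose hY
    simpa using this
  have h1 : (Y₁ᴴ * U * D) *ᵥ (Vᴴ *ᵥ ξ) = 0 := by
    have h2 := congrArg (Y₁ᴴ *ᵥ ·) h
    simp only [Matrix.mulVec_mulVec, Matrix.mul_add, hY', zero_add, Matrix.mulVec_zero] at h2
    rw [Matrix.mulVec_mulVec, ← h2]
    simp only [Matrix.mul_assoc]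
  have hdet : (Y₁ᴴ * U * D).det ≠ 0 := by
    rw [Matrix.det_mul]
    refine mul_ne_zero (fun h0 => hU ?_) hD
    have h3 : Uᴴ * Y₁ = (Y₁ᴴ * U)ᴴ := by simp
    rw [h3, Matrix.det_conjTranspose, h0, star_zero]
  have hV : Vᴴ *ᵥ ξ = 0 := by
    by_contra hne
    exact hdet (Matrix.exists_mulVec_eq_zero_iff.1 ⟨_, hne, h1⟩)
  refine ⟨hV, ?_⟩
  rwa [Matrix.add_mulVec, ← Matrix.mulVec_mulVec, hV, Matrix.mulVec_zero, add_zero] at h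

theorem IsAdaptedBasis.mul_eq_zero {T : Matrix (Fin n) (Fin n) 𝕜} {K : Submodule 𝕜 (Fin n → 𝕜)}
    {X₁ : Matrix (Fin n) (Fin k) 𝕜} {x : Fin n → 𝕜}
    (h : IsAdaptedBasis (LinearMap.ker T.mulVecLin) K X₁ x) : T * X₁ = 0 := by
  refine Matrix.ext_of_mulVec_single fun j => ?_
  set v : Fin k → 𝕜 := Pi.single j 1
  have h1 : X₁ *ᵥ v ∈ LinearMap.ker T.mulVecLin ⊓ K := by
    rw [← h.2.2]
    exact ⟨v, rfl⟩
  have h2 : T *ᵥ (X₁ *ᵥ v) = 0 := h1.1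
  rw [← Matrix.mulVec_mulVec, h2, Matrix.zero_mulVec]

theorem IsAdaptedBasis.left_mem_stiefel {K M : Submodule 𝕜 (Fin n → 𝕜)}
    {X₁ : Matrix (Fin n) (Fin k) 𝕜} {x : Fin n → 𝕜} (h : IsAdaptedBasis K M X₁ x) :
    X₁ ∈ stiefel 𝕜 (Fin n) (Fin k) :=
  submatrix_inl_mem_stiefel h.1

/-- The expansion of a unit vector of `ker T ∩ ker Vᴴ` in an orthonormal basis of `ker T`. -/
theorem IsAdaptedBasis.expansion {T : Matrix (Fin n) (Fin n) 𝕜} {K : Submodule 𝕜 (Fin n → 𝕜)}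
    {X₁ V : Matrix (Fin n) (Fin k) 𝕜} {x ξ : Fin n → 𝕜}
    (h : IsAdaptedBasis (LinearMap.ker T.mulVecLin) K X₁ x) (hV : (Vᴴ * X₁).det ≠ 0)
    (hξ : star ξ ⬝ᵥ ξ = 1) (hTξ : T *ᵥ ξ = 0) (hVξ : Vᴴ *ᵥ ξ = 0) :
    (∃ a : Fin k → 𝕜, ξ = X₁ *ᵥ a + (star x ⬝ᵥ ξ) • x) ∧
      coeffSq (appendCol X₁ x) V (lastVec 𝕜 k) = ‖star x ⬝ᵥ ξ‖ ^ 2 := by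
  set X := appendCol X₁ x with hX
  have hXX : Xᴴ * X = 1 := h.1
  obtain ⟨c, hc⟩ : ∃ c, X *ᵥ c = ξ := by
    have : ξ ∈ LinearMap.range X.mulVecLin := by rw [h.2.1]; exact hTξ
    exact this
  have hcξ : Xᴴ *ᵥ ξ = c := by rw [← hc, Matrix.mulVec_mulVec, hXX, Matrix.one_mulVec]
  have hclast : c (Sum.inr ()) = star x ⬝ᵥ ξ := by rw [← hcξ]; rfl
  have hc1 : star c ⬝ᵥ c = 1 := by
    rw [← hξ, ← hc, Matrix.star_mulVec, Matrix.dotProduct_mulVec, Matrix.vecMul_vecMul, hXX,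
      Matrix.vecMul_one]
  refine ⟨⟨fun i => c (Sum.inl i), ?_⟩, ?_⟩
  · conv_lhs => rw [← hc]
    rw [← hclast]
    ext i
    simp [hX, appendCol, Matrix.mulVec, dotProduct, mul_comm]
  · have hVc : (Vᴴ * X) *ᵥ c = 0 := by rw [← Matrix.mulVec_mulVec, hc, hVξ]
    have hV' : (Vᴴ * X.submatrix id Sum.inl).det ≠ 0 := hV
    rw [coeffSq_eq hV' hc1 hVc, ← hclast]
    simp [lastVec]

end Deterministic

namespace RankCompletingModification

section General

variable {𝕜 : Type*} [RCLike 𝕜] [MeasurableSpace 𝕜] [BorelSpace 𝕜] {n k : ℕ} {Ω : Type*}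
  [MeasurableSpace Ω] {μ : Measure Ω} (S : RankCompletingModification 𝕜 n k μ)

/-- The squared modulus of `α`, as a function of `V` alone. -/
noncomputable def alphaSq (ω : Ω) : ℝ :=
  coeffSq (appendCol S.X₁ S.x) (S.V ω) (lastVec 𝕜 k)

/-- The squared modulus of `β`, as a function of `U` alone. -/
noncomputable def betaSq (ω : Ω) : ℝ :=
  coeffSq (appendCol S.Y₁ S.y) (S.U ω) (lastVec 𝕜 k)

theorem measurable_alphaSq : Measurable S.alphaSq :=
  (measurable_coeffSq_left _ _).comp S.measurable_V

theorem measurable_betaSq : Measurable S.betaSq :=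
  (measurable_coeffSq_left _ _).comp S.measurable_U

theorem indepFun_alphaSq_betaSq : IndepFun S.alphaSq S.betaSq μ :=
  S.indep.symm.comp (measurable_coeffSq_left _ _) (measurable_coeffSq_left _ _)

theorem ae_hasExpansions_and_eq : ∀ᵐ ω ∂μ, S.HasExpansions ω ∧
    S.alphaSq ω = ‖S.α ω‖ ^ 2 ∧ S.betaSq ω = ‖S.β ω‖ ^ 2 := by
  have hV : ∀ᵐ ω ∂μ, ((S.V ω)ᴴ * S.X₁).det ≠ 0 :=
    ae_of_ae_map S.measurable_V.aemeasurable
      (S.uniform_V.ae_det_ne_zero S.basis_right.left_mem_stiefel)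
  have hU : ∀ᵐ ω ∂μ, ((S.U ω)ᴴ * S.Y₁).det ≠ 0 :=
    ae_of_ae_map S.measurable_U.aemeasurable
      (S.uniform_U.ae_det_ne_zero S.basis_left.left_mem_stiefel)
  filter_upwards [hV, hU, S.generic, S.xi_eigenvector, S.yi_eigenvector]
    with ω hV hU hD ⟨hx1, _, hx, _⟩ ⟨hy1, _, hy, _⟩
  set M : Matrix (Fin n) (Fin n) 𝕜 := S.A - S.ev • S.B with hM
  set D : Matrix (Fin k) (Fin k) 𝕜 :=
    S.τ • (Matrix.diagonal (S.dA ω) - S.ev • Matrix.diagonal (S.dB ω)) with hDdef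
  have hDdet : D.det ≠ 0 := by
    rw [hDdef, Matrix.det_smul]
    exact mul_ne_zero (pow_ne_zero _ S.τ_ne_zero) hD
  -- At the eigenvalue, the modified pencil is `M + U D Vᴴ` with `D` invertible.
  have hmod : (S.A + S.τ • (S.U ω * Matrix.diagonal (S.dA ω) * (S.V ω)ᴴ)) -
      S.ev • (S.B + S.τ • (S.U ω * Matrix.diagonal (S.dB ω) * (S.V ω)ᴴ)) =
      M + S.U ω * D * (S.V ω)ᴴ := by
    simp only [hM, hDdef, Matrix.mul_smul, Matrix.smul_mul, Matrix.mul_sub, Matrix.sub_mul,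
      smul_sub, smul_add, smul_comm S.ev S.τ]
    abel
  rw [hmod] at hx hy
  have hx' := mulVec_eq_zero_of_add_mul_mulVec_eq_zero S.basis_left.mul_eq_zero hU hDdet hx
  have hy' : (Mᴴ + S.V ω * Dᴴ * (S.U ω)ᴴ) *ᵥ S.yi ω = 0 := by
    have h1 := congrArg star hy
    rw [Matrix.star_vecMul, star_star, star_zero, Matrix.conjTranspose_add,
      Matrix.conjTranspose_mul, Matrix.conjTranspose_mul, Matrix.conjTranspose_conjTranspose,
      ← Matrix.mul_assoc] at h1
    exact h1
  have hDdet' : Dᴴ.det ≠ 0 := by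
    rw [Matrix.det_conjTranspose]
    exact star_ne_zero.2 hDdet
  have hMX : Mᴴᴴ * S.X₁ = 0 := by
    rw [Matrix.conjTranspose_conjTranspose]
    exact S.basis_right.mul_eq_zero
  have hy'' := mulVec_eq_zero_of_add_mul_mulVec_eq_zero hMX hV hDdet' hy'
  have hxe := S.basis_right.expansion hV hx1 hx'.2 hx'.1
  have hye := S.basis_left.expansion hU hy1 hy''.2 hy''.1
  exact ⟨⟨hxe.1, hye.1, hx'.1, hy''.1⟩, hxe.2, hye.2⟩

theorem map_alphaSq_apply {s : Set ℝ} (hs : MeasurableSet s) :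
    μ.map S.alphaSq s =
      μ.map S.V {V | coeffSq (appendCol S.X₁ S.x) V (lastVec 𝕜 k) ∈ s} := by
  rw [Measure.map_apply S.measurable_alphaSq hs]
  exact (Measure.map_apply S.measurable_V (measurable_coeffSq_left _ _ hs)).symm

theorem map_betaSq_apply {s : Set ℝ} (hs : MeasurableSet s) :
    μ.map S.betaSq s =
      μ.map S.U {U | coeffSq (appendCol S.Y₁ S.y) U (lastVec 𝕜 k) ∈ s} := by
  rw [Measure.map_apply S.measurable_betaSq hs]
  exact (Measure.map_apply S.measurable_U (measurable_coeffSq_left _ _ hs)).symm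

end General

/-! ### The probability estimates -/

theorem measureReal_norm_mul_norm_lt_complex {n k : ℕ} {Ω : Type*} [MeasurableSpace Ω]
    {μ : Measure Ω} [IsProbabilityMeasure μ] (S : RankCompletingModification ℂ n k μ) {t : ℝ}
    (ht0 : 0 < t) (ht1 : t ≤ 1) :
    μ.real {ω | ‖S.α ω‖ * ‖S.β ω‖ < t} ≤ (k : ℝ) ^ 2 * t ^ 2 * (1 - 2 * Real.log t) := by
  have hk : (1 : ℝ) ≤ k := by exact_mod_cast S.one_le_k
  have hk0 : (0 : ℝ) < k := by linarith
  have hlogt : Real.log t ≤ 0 := Real.log_nonpos ht0.le ht1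
  have hlogk : 0 ≤ Real.log k := Real.log_nonneg hk
  rcases lt_or_ge 1 ((k : ℝ) ^ 2 * t ^ 2) with h1 | h1
  · refine measureReal_le_one.trans ?_
    nlinarith
  have hae : {ω | ‖S.α ω‖ * ‖S.β ω‖ < t} =ᵐ[μ] {ω | S.alphaSq ω * S.betaSq ω < t ^ 2} := by
    refine Filter.eventuallyEq_set.2 ?_
    filter_upwards [S.ae_hasExpansions_and_eq] with ω hω
    simp only [hω.2.1, hω.2.2, ← mul_pow]
    exact (pow_lt_pow_iff_left₀ (by positivity) ht0.le two_ne_zero).symm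
  have hPa : IsProbabilityMeasure (μ.map S.alphaSq) :=
    Measure.isProbabilityMeasure_map S.measurable_alphaSq.aemeasurable
  have hPb : IsProbabilityMeasure (μ.map S.betaSq) :=
    Measure.isProbabilityMeasure_map S.measurable_betaSq.aemeasurable
  have hmain := measure_prod_mul_lt_le (P := μ.map S.alphaSq) (Q := μ.map S.betaSq) (c := k)
    (s₀ := 1 / k) (t := t ^ 2) hk0.le (by positivity)
    (fun s hs _ => by
      rw [S.map_alphaSq_apply measurableSet_Iio]
      exact S.uniform_V.measure_coeffSq_lt_le_complex S.one_le_k S.basis_right.1 hs.le)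
    (fun s hs _ => by
      rw [S.map_betaSq_apply measurableSet_Iio]
      exact S.uniform_U.measure_coeffSq_lt_le_complex S.one_le_k S.basis_left.1 hs.le)
    (by
      rw [ae_map_iff S.measurable_betaSq.aemeasurable measurableSet_Ici]
      filter_upwards [S.ae_hasExpansions_and_eq] with ω hω
      rw [hω.2.2]
      positivity)
    (by positivity)
    (by rw [div_pow, one_pow, le_div_iff₀ (by positivity)]; linarith)
  rw [← measure_mul_lt_eq_prod S.measurable_alphaSq S.measurable_betaSq
    S.indepFun_alphaSq_betaSq, ← measure_congr hae] at hmain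
  have hlog : Real.log ((1 / k : ℝ) ^ 2 / t ^ 2) = -2 * Real.log k - 2 * Real.log t := by
    rw [Real.log_div (by positivity) (by positivity), Real.log_pow, Real.log_pow, one_div,
      Real.log_inv]
    push_cast
    ring
  refine ENNReal.toReal_le_of_le_ofReal ?_ (hmain.trans (ENNReal.ofReal_le_ofReal ?_))
  · exact mul_nonneg (by positivity) (by linarith)
  · rw [hlog, mul_one_div_cancel hk0.ne', sub_self, max_self, zero_mul, add_zero, div_div_eq_mul_div,
      div_one]
    have : 0 ≤ (k : ℝ) ^ 2 * t ^ 2 * (2 * Real.log k) := by positivity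
    linarith

theorem exists_measureReal_norm_mul_norm_lt_real {k : ℕ} (hk : 1 ≤ k) :
    ∃ C δ : ℝ, 0 < δ ∧ ∀ (n : ℕ) (Ω : Type*) [MeasurableSpace Ω] (μ : Measure Ω)
      [IsProbabilityMeasure μ] (S : RankCompletingModification ℝ n k μ) (t : ℝ), 0 < t → t < δ →
      μ.real {ω | ‖S.α ω‖ * ‖S.β ω‖ < t} ≤
        2 * (k : ℝ) / Real.pi * (t * (-Real.log t)) + C * t := by
  obtain ⟨s₀, hs₀, hsmall⟩ := exists_measure_coeffSq_lt_le_real hk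
  have hk0 : (0 : ℝ) < k := by exact_mod_cast hk
  set c : ℝ := √(2 * k / Real.pi) with hc
  have hc0 : 0 ≤ c := Real.sqrt_nonneg _
  have hc2 : c ^ 2 = 2 * k / Real.pi := Real.sq_sqrt (by positivity)
  refine ⟨c / s₀ + c ^ 2 * Real.log (s₀ ^ 2) + max 0 (1 - c * s₀) * (c / s₀), s₀ ^ 2,
    by positivity, ?_⟩
  intro n Ω _ μ _ S t ht hts
  have hae : {ω | ‖S.α ω‖ * ‖S.β ω‖ < t} =ᵐ[μ] {ω | √(S.alphaSq ω) * √(S.betaSq ω) < t} := by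
    refine Filter.eventuallyEq_set.2 ?_
    filter_upwards [S.ae_hasExpansions_and_eq] with ω hω
    simp only [hω.2.1, hω.2.2, Real.sqrt_sq (norm_nonneg _)]
  have hma : Measurable fun ω => √(S.alphaSq ω) := S.measurable_alphaSq.sqrt
  have hmb : Measurable fun ω => √(S.betaSq ω) := S.measurable_betaSq.sqrt
  have hPa : IsProbabilityMeasure (μ.map fun ω => √(S.alphaSq ω)) :=
    Measure.isProbabilityMeasure_map hma.aemeasurable
  have hPb : IsProbabilityMeasure (μ.map fun ω => √(S.betaSq ω)) :=
    Measure.isProbabilityMeasure_map hmb.aemeasurable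
  have hpre : ∀ (f : Ω → ℝ) (s : ℝ), 0 < s → (fun ω => √(f ω)) ⁻¹' Set.Iio s =
      f ⁻¹' Set.Iio (s ^ 2) := by
    intro f s hs
    ext ω
    exact Real.sqrt_lt' hs
  have hmain := measure_prod_mul_lt_le (P := μ.map fun ω => √(S.alphaSq ω))
    (Q := μ.map fun ω => √(S.betaSq ω)) (c := c) (s₀ := s₀) (t := t) hc0 hs₀
    (fun s hs hs' => by
      rw [Measure.map_apply hma measurableSet_Iio, hpre _ _ hs,
        ← Measure.map_apply S.measurable_alphaSq measurableSet_Iio,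
        S.map_alphaSq_apply measurableSet_Iio]
      exact hsmall n _ S.uniform_V _ S.basis_right.1 s hs hs')
    (fun s hs hs' => by
      rw [Measure.map_apply hmb measurableSet_Iio, hpre _ _ hs,
        ← Measure.map_apply S.measurable_betaSq measurableSet_Iio,
        S.map_betaSq_apply measurableSet_Iio]
      exact hsmall n _ S.uniform_U _ S.basis_left.1 s hs hs')
    (by
      rw [ae_map_iff hmb.aemeasurable measurableSet_Ici]
      exact ae_of_all _ fun ω => Real.sqrt_nonneg _)
    ht hts.le
  rw [← measure_mul_lt_eq_prod hma hmb
    (S.indepFun_alphaSq_betaSq.comp Real.continuous_sqrt.measurable Real.continuous_sqrt.measurable),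
    ← measure_congr hae] at hmain
  have hrhs : c * (t / s₀ + c * t * Real.log (s₀ ^ 2 / t)) +
      max 0 (1 - c * s₀) * (c * (t / s₀)) =
      2 * (k : ℝ) / Real.pi * (t * (-Real.log t)) +
        (c / s₀ + c ^ 2 * Real.log (s₀ ^ 2) + max 0 (1 - c * s₀) * (c / s₀)) * t := by
    rw [← hc2, Real.log_div (by positivity) ht.ne']
    ring
  rw [← hrhs]
  refine ENNReal.toReal_le_of_le_ofReal ?_ hmain
  have hlog : 0 ≤ Real.log (s₀ ^ 2 / t) := Real.log_nonneg ((one_le_div ht).2 hts.le)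
  positivity

end RankCompletingModification

end SingularPencil

theorem proposition4p8 (k : ℕ) :
    (∀ (n : ℕ) (Ω : Type*) [MeasurableSpace Ω] (μ : Measure Ω) [IsProbabilityMeasure μ]
      (S : SingularPencil.RankCompletingModification ℂ n k μ),
      (∀ᵐ ω ∂μ, S.HasExpansions ω) ∧
      ∀ t : ℝ, 0 < t → t ≤ 1 →
        μ.real {ω | ‖S.α ω‖ * ‖S.β ω‖ < t} ≤ (k : ℝ) ^ 2 * t ^ 2 * (1 - 2 * Real.log t)) ∧
    (∃ C δ : ℝ, 0 < δ ∧
      ∀ (n : ℕ) (Ω : Type*) [MeasurableSpace Ω] (μ : Measure Ω) [IsProbabilityMeasure μ]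
      (S : SingularPencil.RankCompletingModification ℝ n k μ),
      (∀ᵐ ω ∂μ, S.HasExpansions ω) ∧
      ∀ t : ℝ, 0 < t → t < δ →
        μ.real {ω | ‖S.α ω‖ * ‖S.β ω‖ < t} ≤
          2 * (k : ℝ) / Real.pi * (t * (-Real.log t)) + C * t) := by
  refine ⟨fun n Ω _ μ _ S => ⟨S.ae_hasExpansions_and_eq.mono fun ω h => h.1,
    fun t ht0 ht1 => S.measureReal_norm_mul_norm_lt_complex ht0 ht1⟩, ?_⟩
  rcases Nat.eq_zero_or_pos k with rfl | hk
  · exact ⟨0, 1, one_pos, fun n Ω _ μ _ S => absurd S.one_le_k (by norm_num)⟩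
  · obtain ⟨C, δ, hδ, h⟩ :=
      SingularPencil.RankCompletingModification.exists_measureReal_norm_mul_norm_lt_real hk
    exact ⟨C, δ, hδ, fun n Ω _ μ _ S =>
      ⟨S.ae_hasExpansions_and_eq.mono fun ω h => h.1, fun t ht0 ht => h n Ω μ S t ht0 ht⟩⟩
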